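/- **Conventions.** $G$ is a locally compact (Hausdorff) abelian group, written additively, with a fixed (regular) Haar measure $ds$, and $\mathbb C$ is regarded as an additive group. A *Young function* is a nonzero convex function $\Phi:[0,\infty)\to[0,\infty]$ with $\Phi(0)=0$ and $\lim_{x\to\infty}\Phi(x)=\infty$; its *complementary function* is $y\mapsto\sup\{xy-\Phi(x):x\ge 0\}$. $L^\Phi(G)$ is the space of (a.e. classes of) measurable $f:G\to\mathbb C$ such that $\int_G\Phi(\alpha|f(s)|)\,ds<\infty$ for some $\alpha>0$. Let $(\Phi,\Psi)$ be a *complementary pair*, i.e. $\Phi$ and $\Psi$ are continuous, strictly increasing Young functions and $\Psi$ is the complementary function of $\Phi$. Then $L^\Phi(G)$ carries the norm $\|f\|_\Phi=\sup\{\int_G|fv|\,ds:\int_G\Psi(|v|)\,ds\le1\}$, and $\mathcal S^\Phi(G)$ is the closure in $L^\Phi(G)$ of the linear space of all step functions in $L^\Phi(G)$. A *weight* is a measurable, locally integrable function $\omega:G\to(0,\infty)$ with $\omega(0)=1$, $1/\omega\in L^\infty(G)$ and $\omega(s+t)\le C\omega(s)\omega(t)$ for all $s,t\in G$ and some constant $C>0$.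 Put $L^\Phi_\omega(G)=\{f:f\omega\in L^\Phi(G)\}$ with norm $\|f\|_{\Phi,\omega}=\|f\omega\|_\Phi$, and $\mathcal S^\Phi_\omega(G)=\{f:f\omega\in\mathcal S^\Phi(G)\}$. We say that $L^\Phi_\omega(G)$ is a *Banach algebra under convolution* if for all $f,g\in L^\Phi_\omega(G)$ the integral $(f*g)(x)=\int_G f(t)g(x-t)\,dt$ converges absolutely for almost every $x$, $f*g\in L^\Phi_\omega(G)$, and $\|f*g\|_{\Phi,\omega}\le K\|f\|_{\Phi,\omega}\|g\|_{\Phi,\omega}$ with a constant $K$. A Banach algebra $A$ (with bounded, not necessarily contractive, product) is *weakly amenable* if every bounded derivation $D:A\to A^*$, i.e. every bounded linear map with $\langle D(ab),c\rangle=\langle D(b),ca\rangle+\langle D(a),bc\rangle$, is inner, i.e. of the form $\langle D(a),c\rangle=\varphi(ca)-\varphi(ac)$ for some $\varphi\in A^*$. Finally $\check h(s)=h(-s)$. **Theorem.** Let $G$ be a locally compact abelian group, $\omega$ a weight on $G$, and $(\Phi,\Psi)$ a complementary pair such that $L^\Phi_\omega(G)$ is a Banach algebra under convolution. Let $\xi:G\to\mathbb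 C$ be a nonzero continuous group homomorphism such that $$\tilde\xi(s):=\frac{\xi(s)}{\omega(s)\,\omega(-s)}\qquad(s\in G)$$ belongs to $L^\infty(G)$. Assume that one of the following holds: (i) $x\mapsto\Psi(\sqrt x)$ is a Young function; (ii) $\tilde\Phi(x):=\Phi(\sqrt x)$ is a Young function and $\tilde\xi\in L^{\tilde\Psi}(G)$, where $\tilde\Psi$ is the complementary function of $\tilde\Phi$. Then $\mathcal S^\Phi_\omega(G)$ is a subalgebra of $L^\Phi_\omega(G)$, and neither $L^\Phi_\omega(G)$ nor $\mathcal S^\Phi_\omega(G)$ is weakly amenable. More precisely, for every compact neighbourhood $U$ of $0$ in $G$ the formula $$\langle D(f),g\rangle=\int_G\bigl(1_U*(\check f\,\check\xi)\bigr)(t)\,g(t)\,dt\qquad(f,g\in L^\Phi_\omega(G)),$$ in which all integrals converge absolutely, defines a bounded derivation $D:L^\Phi_\omega(G)\to L^\Phi_\omega(G)^*$ that is not inner, and restricting $f$ and $g$ to $\mathcal S^\Phi_\omega(G)$ gives a bounded derivation $\mathcal S^\Phi_\omega(G)\to\mathcal S^\Phi_\omega(G)^*$ that is not inner. -/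

import Mathlib

open MeasureTheory Filter Topology
open scoped ENNReal NNReal Convolution

noncomputable section

namespace WeightedOrlicz

/-! ### Young functions -/

/-- A Young function `Φ : [0,∞) → [0,∞]`: nonzero, convex, `Φ 0 = 0`, `Φ x → ∞` as `x → ∞`. -/
structure IsYoung (Φ : ℝ≥0 → ℝ≥0∞) : Prop where
  ne_zero : Φ ≠ 0
  convex : ConvexOn ℝ≥0 Set.univ Φ
  map_zero : Φ 0 = 0
  tendsto_top : Tendsto Φ atTop (𝓝 ∞)

/-- The complementary function `Ψ y = sup {x y - Φ x : x ≥ 0}`. The truncated subtraction of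
`ℝ≥0∞` does no harm here, since the term `x = 0` makes the supremum nonnegative when `Φ 0 = 0`. -/
def complementary (Φ : ℝ≥0 → ℝ≥0∞) (y : ℝ≥0) : ℝ≥0∞ :=
  ⨆ x : ℝ≥0, ((x * y : ℝ≥0) : ℝ≥0∞) - Φ x

/-- A complementary pair of continuous strictly increasing Young functions. -/
structure YoungPair where
  Φ : ℝ≥0 → ℝ≥0∞
  Ψ : ℝ≥0 → ℝ≥0∞
  young_Φ : IsYoung Φ
  young_Ψ : IsYoung Ψ
  compl_eq : Ψ = complementary Φ
  continuous_Φ : Continuous Φ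
  continuous_Ψ : Continuous Ψ
  strictMono_Φ : StrictMono Φ
  strictMono_Ψ : StrictMono Ψ

theorem young_inequality (Φ : ℝ≥0 → ℝ≥0∞) (x y : ℝ≥0) :
    ((x * y : ℝ≥0) : ℝ≥0∞) ≤ Φ x + complementary Φ y :=
  tsub_le_iff_left.1 (le_iSup (fun x : ℝ≥0 => ((x * y : ℝ≥0) : ℝ≥0∞) - Φ x) x)

/-! ### Orlicz spaces -/

section Orlicz

variable {α : Type*} [MeasurableSpace α]

/-- `f ∈ L^Φ(μ)`: `f` is measurable and `∫ Φ(a |f|) dμ < ∞` for some `a > 0`. -/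
def MemOrlicz (Φ : ℝ≥0 → ℝ≥0∞) (f : α → ℂ) (μ : Measure α) : Prop :=
  AEStronglyMeasurable f μ ∧ ∃ a : ℝ≥0, 0 < a ∧ ∫⁻ x, Φ (a * ‖f x‖₊) ∂μ < ∞

/-- The Orlicz norm `sup {∫ |f v| dμ : ∫ Ψ(|v|) dμ ≤ 1}`, with values in `[0,∞]`. -/
def eOrliczNorm (Ψ : ℝ≥0 → ℝ≥0∞) (f : α → ℂ) (μ : Measure α) : ℝ≥0∞ :=
  ⨆ (v : α → ℂ) (_ : AEStronglyMeasurable v μ) (_ : ∫⁻ x, Ψ ‖v x‖₊ ∂μ ≤ 1),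
    ∫⁻ x, ‖f x * v x‖ₑ ∂μ

variable {μ : Measure α}

theorem MemOrlicz.congr {Φ : ℝ≥0 → ℝ≥0∞} {f g : α → ℂ} (h : f =ᵐ[μ] g)
    (hf : MemOrlicz Φ f μ) : MemOrlicz Φ g μ := by
  obtain ⟨hm, a, ha, hi⟩ := hf
  refine ⟨hm.congr h, a, ha, ?_⟩
  rwa [lintegral_congr_ae (g := fun x => Φ (a * ‖f x‖₊))]
  filter_upwards [h] with x hx
  rw [hx]

theorem MemOrlicz.add (P : YoungPair) {f g : α → ℂ} (hf : MemOrlicz P.Φ f μ)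
    (hg : MemOrlicz P.Φ g μ) : MemOrlicz P.Φ (f + g) μ := by
  obtain ⟨hfm, a, ha, hfi⟩ := hf
  obtain ⟨hgm, b, hb, hgi⟩ := hg
  have hmono := P.strictMono_Φ.monotone
  refine ⟨hfm.add hgm, min a b / 2, by positivity, ?_⟩
  have hmeas : AEMeasurable (fun x => P.Φ (a * ‖f x‖₊)) μ :=
    P.continuous_Φ.measurable.comp_aemeasurable (hfm.nnnorm.aemeasurable.const_mul a)
  refine lt_of_le_of_lt (b := ∫⁻ x, (P.Φ (a * ‖f x‖₊) + P.Φ (b * ‖g x‖₊)) ∂μ) ?_ ?_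
  · refine lintegral_mono fun x => ?_
    have h1 : min a b / 2 * ‖(f + g) x‖₊ ≤ max (a * ‖f x‖₊) (b * ‖g x‖₊) := by
      calc min a b / 2 * ‖(f + g) x‖₊
          ≤ min a b / 2 * (‖f x‖₊ + ‖g x‖₊) := by gcongr; exact nnnorm_add_le _ _
        _ = (min a b * ‖f x‖₊ + min a b * ‖g x‖₊) / 2 := by ring
        _ ≤ (a * ‖f x‖₊ + b * ‖g x‖₊) / 2 := by
            gcongr
            · exact min_le_left _ _
            · exact min_le_right _ _
        _ ≤ (max (a * ‖f x‖₊) (b * ‖g x‖₊) + max (a * ‖f x‖₊) (b * ‖g x‖₊)) / 2 := by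
            gcongr
            · exact le_max_left _ _
            · exact le_max_right _ _
        _ = max (a * ‖f x‖₊) (b * ‖g x‖₊) := by rw [add_self_div_two]
    refine (hmono h1).trans ?_
    rcases le_total (a * ‖f x‖₊) (b * ‖g x‖₊) with h | h
    · rw [max_eq_right h]; exact le_add_self
    · rw [max_eq_left h]; exact le_self_add
  · rw [lintegral_add_left' hmeas]
    exact ENNReal.add_lt_top.2 ⟨hfi, hgi⟩

theorem MemOrlicz.const_smul (P : YoungPair) {f : α → ℂ} (c : ℂ) (hf : MemOrlicz P.Φ f μ) :
    MemOrlicz P.Φ (c • f) μ := by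
  obtain ⟨hfm, a, ha, hfi⟩ := hf
  refine ⟨hfm.const_smul c, a / (‖c‖₊ + 1), by positivity, lt_of_le_of_lt ?_ hfi⟩
  refine lintegral_mono fun x => P.strictMono_Φ.monotone ?_
  rw [Pi.smul_apply, nnnorm_smul, ← mul_assoc]
  gcongr
  rw [div_mul_eq_mul_div, div_le_iff₀ (by positivity)]
  gcongr
  exact le_self_add

theorem memOrlicz_zero (P : YoungPair) : MemOrlicz P.Φ (0 : α → ℂ) μ :=
  ⟨aestronglyMeasurable_zero, 1, one_pos, by simp [P.young_Φ.map_zero]⟩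

variable (μ) in
/-- The Orlicz space `L^Φ(μ)`, a space of classes of a.e. equal measurable functions. -/
def OrliczSpace (P : YoungPair) : Submodule ℂ (α →ₘ[μ] ℂ) where
  carrier := {f | MemOrlicz P.Φ f μ}
  add_mem' {f g} hf hg := (hf.add P hg).congr (AEEqFun.coeFn_add f g).symm
  zero_mem' := (memOrlicz_zero P).congr AEEqFun.coeFn_zero.symm
  smul_mem' c f hf := (hf.const_smul P c).congr (AEEqFun.coeFn_smul c f).symm

theorem eOrliczNorm_congr {Ψ : ℝ≥0 → ℝ≥0∞} {f g : α → ℂ} (h : f =ᵐ[μ] g) :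
    eOrliczNorm Ψ f μ = eOrliczNorm Ψ g μ := by
  unfold eOrliczNorm
  refine iSup_congr fun v => iSup_congr fun _ => iSup_congr fun _ => lintegral_congr_ae ?_
  filter_upwards [h] with x hx
  rw [hx]

theorem eOrliczNorm_add_le {Ψ : ℝ≥0 → ℝ≥0∞} {f g : α → ℂ} (hf : AEStronglyMeasurable f μ) :
    eOrliczNorm Ψ (f + g) μ ≤ eOrliczNorm Ψ f μ + eOrliczNorm Ψ g μ := by
  refine iSup_le fun v => iSup_le fun hv => iSup_le fun hvi => ?_
  calc ∫⁻ x, ‖(f + g) x * v x‖ₑ ∂μ ≤ ∫⁻ x, (‖f x * v x‖ₑ + ‖g x * v x‖ₑ) ∂μ := by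
        refine lintegral_mono fun x => ?_
        rw [Pi.add_apply, add_mul]
        exact enorm_add_le _ _
    _ = ∫⁻ x, ‖f x * v x‖ₑ ∂μ + ∫⁻ x, ‖g x * v x‖ₑ ∂μ :=
        lintegral_add_left' (hf.mul hv).enorm _
    _ ≤ _ := by
        gcongr
        · exact le_iSup₂_of_le v hv (le_iSup_of_le hvi le_rfl)
        · exact le_iSup₂_of_le v hv (le_iSup_of_le hvi le_rfl)

theorem eOrliczNorm_const_smul {Ψ : ℝ≥0 → ℝ≥0∞} (c : ℂ) (f : α → ℂ) :
    eOrliczNorm Ψ (c • f) μ = ‖c‖ₑ * eOrliczNorm Ψ f μ := by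
  unfold eOrliczNorm
  simp only [ENNReal.mul_iSup]
  refine iSup_congr fun v => iSup_congr fun _ => iSup_congr fun _ => ?_
  rw [← lintegral_const_mul' _ _ enorm_ne_top]
  refine lintegral_congr fun x => ?_
  rw [Pi.smul_apply, smul_eq_mul, mul_assoc, enorm_mul]

theorem MemOrlicz.eOrliczNorm_lt_top (P : YoungPair) {f : α → ℂ} (hf : MemOrlicz P.Φ f μ) :
    eOrliczNorm P.Ψ f μ < ∞ := by
  obtain ⟨hfm, a, ha, hfi⟩ := hf
  refine lt_of_le_of_lt (b := (a : ℝ≥0∞)⁻¹ * (∫⁻ x, P.Φ (a * ‖f x‖₊) ∂μ + 1)) ?_ ?_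
  · refine iSup_le fun v => iSup_le fun hv => iSup_le fun hvi => ?_
    have ha' : (a : ℝ≥0∞) ≠ 0 := by simpa using ha.ne'
    rw [← ENNReal.mul_le_iff_le_inv ha' ENNReal.coe_ne_top,
      ← lintegral_const_mul' _ _ ENNReal.coe_ne_top]
    have hmeas : AEMeasurable (fun x => P.Φ (a * ‖f x‖₊)) μ :=
      P.continuous_Φ.measurable.comp_aemeasurable (hfm.nnnorm.aemeasurable.const_mul a)
    calc ∫⁻ x, (a : ℝ≥0∞) * ‖f x * v x‖ₑ ∂μ
        ≤ ∫⁻ x, (P.Φ (a * ‖f x‖₊) + P.Ψ ‖v x‖₊) ∂μ := by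
          refine lintegral_mono fun x => ?_
          have h := young_inequality P.Φ (a * ‖f x‖₊) ‖v x‖₊
          rw [← P.compl_eq] at h
          refine le_trans (le_of_eq ?_) h
          rw [enorm_mul, enorm_eq_nnnorm, enorm_eq_nnnorm]
          push_cast
          ring
      _ = ∫⁻ x, P.Φ (a * ‖f x‖₊) ∂μ + ∫⁻ x, P.Ψ ‖v x‖₊ ∂μ := lintegral_add_left' hmeas _
      _ ≤ _ := by gcongr
  · exact ENNReal.mul_lt_top (by simpa using ha)
      (ENNReal.add_lt_top.2 ⟨hfi, ENNReal.one_lt_top⟩)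

theorem MemOrlicz.ae_eq_zero (P : YoungPair) {f : α → ℂ} (hf : MemOrlicz P.Φ f μ)
    (h0 : eOrliczNorm P.Ψ f μ = 0) : f =ᵐ[μ] 0 := by
  obtain ⟨hfm, a, ha, hfi⟩ := hf
  have hmeas : AEMeasurable (fun x => P.Φ (a * ‖f x‖₊)) μ :=
    P.continuous_Φ.measurable.comp_aemeasurable (hfm.nnnorm.aemeasurable.const_mul a)
  have hset : ∀ n : ℕ, μ {x | 1 / ((n : ℝ≥0) + 1) ≤ ‖f x‖₊} = 0 := by
    intro n
    set e : ℝ≥0 := 1 / ((n : ℝ≥0) + 1) with he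
    have hepos : 0 < e := by positivity
    set S := {x | e ≤ ‖f x‖₊} with hS
    have hSm : NullMeasurableSet S μ :=
      nullMeasurableSet_le aemeasurable_const hfm.nnnorm.aemeasurable
    have hae : 0 < P.Φ (a * e) := by
      rw [← P.young_Φ.map_zero]
      exact P.strictMono_Φ (by positivity)
    have hfin : μ S ≠ ∞ := by
      intro htop
      have h1 := mul_meas_ge_le_lintegral₀ hmeas (P.Φ (a * e))
      have h2 : S ⊆ {x | P.Φ (a * e) ≤ P.Φ (a * ‖f x‖₊)} := fun x hx =>
        P.strictMono_Φ.monotone (mul_le_mul_right hx a)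
      have h3 : μ {x | P.Φ (a * e) ≤ P.Φ (a * ‖f x‖₊)} = ∞ :=
        top_le_iff.1 (htop ▸ measure_mono h2)
      rw [h3, ENNReal.mul_top hae.ne'] at h1
      exact absurd hfi (not_lt.2 h1)
    -- a small constant `c` with `Ψ c * μ S ≤ 1`
    obtain ⟨c, hc, hc1⟩ : ∃ c : ℝ≥0, 0 < c ∧ P.Ψ c * μ S ≤ 1 := by
      have ht : Tendsto (fun c => P.Ψ c * μ S) (𝓝 0) (𝓝 (P.Ψ 0 * μ S)) :=
        ENNReal.Tendsto.mul_const (P.continuous_Ψ.tendsto 0) (Or.inr hfin)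
      rw [P.young_Ψ.map_zero, zero_mul] at ht
      have hev := (ht.eventually (gt_mem_nhds (zero_lt_one))).filter_mono
        (nhdsWithin_le_nhds (s := Set.Ioi 0))
      obtain ⟨c, h1, h2⟩ := (hev.and self_mem_nhdsWithin).exists
      exact ⟨c, h2, h1.le⟩
    have hle : ∫⁻ x, ‖f x * S.indicator (fun _ => ((c : ℝ) : ℂ)) x‖ₑ ∂μ ≤ 0 := by
      rw [← h0]
      refine le_iSup₂_of_le (S.indicator (fun _ => ((c : ℝ) : ℂ)))
        (aestronglyMeasurable_const.indicator₀ hSm) (le_iSup_of_le ?_ le_rfl)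
      have : ∀ x, P.Ψ ‖S.indicator (fun _ => ((c : ℝ) : ℂ)) x‖₊
          = S.indicator (fun _ => P.Ψ c) x := by
        intro x
        by_cases hx : x ∈ S
        · have : ‖((c : ℝ) : ℂ)‖₊ = c := by ext; simp
          rw [Set.indicator_of_mem hx, Set.indicator_of_mem hx, this]
        · rw [Set.indicator_of_notMem hx, Set.indicator_of_notMem hx, nnnorm_zero,
            P.young_Ψ.map_zero]
      simp only [this]
      rwa [lintegral_indicator_const₀ hSm]
    have hge : (e * c : ℝ≥0∞) * μ S
        ≤ ∫⁻ x, ‖f x * S.indicator (fun _ => ((c : ℝ) : ℂ)) x‖ₑ ∂μ := by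
      rw [← lintegral_indicator_const₀ hSm]
      refine lintegral_mono fun x => ?_
      by_cases hx : x ∈ S
      · have hcn : ‖((c : ℝ) : ℂ)‖ₑ = c := by
          rw [enorm_eq_nnnorm]; congr 1; ext; simp
        rw [Set.indicator_of_mem hx, Set.indicator_of_mem hx, enorm_mul, hcn]
        gcongr
        rw [enorm_eq_nnnorm]
        exact ENNReal.coe_le_coe.2 hx
      · rw [Set.indicator_of_notMem hx]; exact zero_le
    have hz := le_antisymm (hge.trans hle) (zero_le)
    rcases mul_eq_zero.1 hz with h | h
    · exfalso
      rcases mul_eq_zero.1 h with h | h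
      · exact hepos.ne' (by simpa using h)
      · exact hc.ne' (by simpa using h)
    · exact h
  have hU : μ (⋃ n : ℕ, {x | 1 / ((n : ℝ≥0) + 1) ≤ ‖f x‖₊}) = 0 := measure_iUnion_null hset
  refine measure_mono_null (fun x hx => ?_) hU
  have hx' : 0 < ‖f x‖₊ := by simpa [pos_iff_ne_zero] using hx
  obtain ⟨n, hn⟩ := exists_nat_one_div_lt (K := ℝ) (ε := ‖f x‖) (by simpa using hx)
  refine Set.mem_iUnion.2 ⟨n, ?_⟩
  have : ((1 / ((n : ℝ≥0) + 1) : ℝ≥0) : ℝ) ≤ ‖f x‖ := by push_cast; exact hn.le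
  exact_mod_cast this

instance (P : YoungPair) : Norm (OrliczSpace μ P) where
  norm f := (eOrliczNorm P.Ψ (f : α →ₘ[μ] ℂ) μ).toReal

theorem OrliczSpace.norm_def (P : YoungPair) (f : OrliczSpace μ P) :
    ‖f‖ = (eOrliczNorm P.Ψ (f : α →ₘ[μ] ℂ) μ).toReal := rfl

theorem OrliczSpace.core (P : YoungPair) : NormedSpace.Core ℂ (OrliczSpace μ P) where
  norm_nonneg _ := ENNReal.toReal_nonneg
  norm_smul c f := by
    rw [OrliczSpace.norm_def, OrliczSpace.norm_def, Submodule.coe_smul,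
      eOrliczNorm_congr (AEEqFun.coeFn_smul c (f : α →ₘ[μ] ℂ)), eOrliczNorm_const_smul,
      ENNReal.toReal_mul, toReal_enorm]
  norm_triangle f g := by
    have hf := MemOrlicz.eOrliczNorm_lt_top P f.2
    have hg := MemOrlicz.eOrliczNorm_lt_top P g.2
    rw [OrliczSpace.norm_def, OrliczSpace.norm_def, OrliczSpace.norm_def, Submodule.coe_add,
      eOrliczNorm_congr (AEEqFun.coeFn_add (f : α →ₘ[μ] ℂ) g),
      ← ENNReal.toReal_add hf.ne hg.ne]
    exact ENNReal.toReal_mono (ENNReal.add_lt_top.2 ⟨hf, hg⟩).ne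
      (eOrliczNorm_add_le (AEEqFun.aestronglyMeasurable _))
  norm_eq_zero_iff f := by
    constructor
    · intro h
      rw [OrliczSpace.norm_def, ENNReal.toReal_eq_zero_iff] at h
      rcases h with h | h
      · exact Subtype.ext (AEEqFun.ext
          ((MemOrlicz.ae_eq_zero P f.2 h).trans AEEqFun.coeFn_zero.symm))
      · exact absurd h (MemOrlicz.eOrliczNorm_lt_top P f.2).ne
    · rintro rfl
      rw [OrliczSpace.norm_def, Submodule.coe_zero, eOrliczNorm_congr AEEqFun.coeFn_zero]
      simp [eOrliczNorm]

instance (P : YoungPair) : NormedAddCommGroup (OrliczSpace μ P) :=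
  NormedAddCommGroup.ofCore (OrliczSpace.core P)

instance (P : YoungPair) : NormedSpace ℂ (OrliczSpace μ P) :=
  NormedSpace.ofCore (OrliczSpace.core P)

variable (μ) in
/-- `S^Φ(μ)`: the closure in `L^Φ(μ)` of the linear space of step functions, i.e. of the linear
span of the indicator functions of measurable sets that lie in `L^Φ(μ)`. -/
def StepClosure (P : YoungPair) : Submodule ℂ (OrliczSpace μ P) :=
  (Submodule.span ℂ {f : OrliczSpace μ P | ∃ E : Set α, MeasurableSet E ∧
    (f : α →ₘ[μ] ℂ) =ᵐ[μ] E.indicator (fun _ => (1 : ℂ))}).topologicalClosure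

end Orlicz

/-! ### Weighted Orlicz spaces -/

section Weighted

variable {G : Type*} [AddCommGroup G] [TopologicalSpace G] [MeasurableSpace G]

/-- A weight on the (additively written) group `G`; it is only weakly submultiplicative. -/
structure Weight (μ : Measure G) where
  toFun : G → ℝ
  pos : ∀ s, 0 < toFun s
  aemeasurable : AEMeasurable toFun μ
  locallyIntegrable : LocallyIntegrable toFun μ
  map_zero : toFun 0 = 1
  inv_memLp_top : MemLp (fun s => (toFun s)⁻¹) ∞ μ
  submul : ∃ C : ℝ, 0 < C ∧ ∀ s t, toFun (s + t) ≤ C * (toFun s * toFun t)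

instance (μ : Measure G) : CoeFun (Weight μ) fun _ => G → ℝ := ⟨Weight.toFun⟩

variable {μ : Measure G}

/-- The a.e. class of the complex-valued function `ω`. -/
def Weight.toAEEqFun (ω : Weight μ) : G →ₘ[μ] ℂ :=
  AEEqFun.mk (fun s => (ω s : ℂ))
    (Complex.measurable_ofReal.comp_aemeasurable ω.aemeasurable).aestronglyMeasurable

theorem Weight.coeFn_mul (ω : Weight μ) (f : G →ₘ[μ] ℂ) :
    ω.toAEEqFun * f =ᵐ[μ] fun s => (ω s : ℂ) * f s := by
  filter_upwards [AEEqFun.coeFn_mul ω.toAEEqFun f, AEEqFun.coeFn_mk (fun s => (ω s : ℂ))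
    (Complex.measurable_ofReal.comp_aemeasurable ω.aemeasurable).aestronglyMeasurable] with s h1 h2
  rw [h1, Pi.mul_apply]
  exact congrArg (· * f s) h2

/-- Multiplication by `ω` on classes of measurable functions. -/
def Weight.mulMap (ω : Weight μ) : (G →ₘ[μ] ℂ) →ₗ[ℂ] (G →ₘ[μ] ℂ) where
  toFun f := ω.toAEEqFun * f
  map_add' f g := by
    refine AEEqFun.ext ?_
    filter_upwards [ω.coeFn_mul (f + g), ω.coeFn_mul f, ω.coeFn_mul g, AEEqFun.coeFn_add f g,
      AEEqFun.coeFn_add (ω.toAEEqFun * f) (ω.toAEEqFun * g)] with s h1 h2 h3 h4 h5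
    rw [h1, h5, Pi.add_apply, h2, h3, h4, Pi.add_apply, mul_add]
  map_smul' c f := by
    refine AEEqFun.ext ?_
    filter_upwards [ω.coeFn_mul (c • f), ω.coeFn_mul f, AEEqFun.coeFn_smul c f,
      AEEqFun.coeFn_smul c (ω.toAEEqFun * f)] with s h1 h2 h3 h4
    simp only [RingHom.id_apply]
    rw [h1, h4, Pi.smul_apply, h2, h3, Pi.smul_apply, smul_eq_mul, smul_eq_mul, mul_left_comm]

theorem Weight.mulMap_injective (ω : Weight μ) : Function.Injective ω.mulMap := by
  rw [← LinearMap.ker_eq_bot, LinearMap.ker_eq_bot']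
  intro f hf
  refine AEEqFun.ext ?_
  have h0 : (ω.toAEEqFun * f : G →ₘ[μ] ℂ) =ᵐ[μ] (0 : G →ₘ[μ] ℂ) := by
    have : ω.toAEEqFun * f = 0 := hf
    rw [this]
  filter_upwards [ω.coeFn_mul f, h0, AEEqFun.coeFn_zero (α := G) (β := ℂ) (μ := μ)]
    with s h1 h2 h3
  rw [h1, h3] at h2
  rw [h3]
  rcases mul_eq_zero.1 h2 with h | h
  · exact absurd (Complex.ofReal_eq_zero.1 h) (ω.pos s).ne'
  · exact h

/-- The weighted Orlicz space `L^Φ_ω(G) = {f : f ω ∈ L^Φ(G)}`. -/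
def WeightedOrliczSpace (P : YoungPair) (ω : Weight μ) : Submodule ℂ (G →ₘ[μ] ℂ) :=
  (OrliczSpace μ P).comap ω.mulMap

/-- The map `f ↦ f ω` from `L^Φ_ω(G)` to `L^Φ(G)`. -/
def WeightedOrliczSpace.mulWeight (P : YoungPair) (ω : Weight μ) :
    WeightedOrliczSpace P ω →ₗ[ℂ] OrliczSpace μ P :=
  ω.mulMap.restrict (fun _ hf => hf)

theorem WeightedOrliczSpace.mulWeight_injective (P : YoungPair) (ω : Weight μ) :
    Function.Injective (WeightedOrliczSpace.mulWeight P ω) := fun _ _ h =>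
  Subtype.ext (ω.mulMap_injective (congrArg Subtype.val h))

/-- The norm `‖f‖_{Φ,ω} = ‖f ω‖_Φ`. -/
instance (P : YoungPair) (ω : Weight μ) : NormedAddCommGroup (WeightedOrliczSpace P ω) :=
  NormedAddCommGroup.induced _ _ (WeightedOrliczSpace.mulWeight P ω)
    (WeightedOrliczSpace.mulWeight_injective P ω)

instance (P : YoungPair) (ω : Weight μ) : NormedSpace ℂ (WeightedOrliczSpace P ω) :=
  NormedSpace.induced ℂ _ _ (WeightedOrliczSpace.mulWeight P ω)

/-- `S^Φ_ω(G) = {f : f ω ∈ S^Φ(G)}`, a subspace of `L^Φ_ω(G)`. -/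
def WeightedStepClosure (P : YoungPair) (ω : Weight μ) :
    Submodule ℂ (WeightedOrliczSpace P ω) :=
  (StepClosure μ P).comap (WeightedOrliczSpace.mulWeight P ω)

/-- `L^Φ_ω(G)` is a Banach algebra under convolution, with the bounded bilinear product `m`:
for all `f, g ∈ L^Φ_ω(G)` the convolution integral `∫ f(t) g(x - t) dt` converges absolutely for
almost every `x`, and `m f g` is the class of the function `f * g` so obtained. -/
def IsConvolutionProduct (P : YoungPair) (ω : Weight μ)
    (m : WeightedOrliczSpace P ω →L[ℂ] WeightedOrliczSpace P ω →L[ℂ] WeightedOrliczSpace P ω) :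
    Prop :=
  ∀ f g : WeightedOrliczSpace P ω,
    (∀ᵐ x ∂μ, ConvolutionExistsAt (f : G →ₘ[μ] ℂ) (g : G →ₘ[μ] ℂ) x
      (ContinuousLinearMap.mul ℂ ℂ) μ) ∧
    ((m f g : WeightedOrliczSpace P ω) : G →ₘ[μ] ℂ) =ᵐ[μ]
      ((f : G →ₘ[μ] ℂ) ⋆[ContinuousLinearMap.mul ℂ ℂ, μ] (g : G →ₘ[μ] ℂ))

end Weighted

/-! ### Weak amenability -/

section Amenability

variable {A : Type*} [NormedAddCommGroup A] [NormedSpace ℂ A]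

/-- `D : A → A*` is a derivation of the algebra with product `m`:
`D(ab) = a · D(b) + D(a) · b`, where `(a · φ)(c) = φ(ca)` and `(φ · a)(c) = φ(ac)`. -/
def IsDerivation (m : A →L[ℂ] A →L[ℂ] A) (D : A →L[ℂ] A →L[ℂ] ℂ) : Prop :=
  ∀ a b c : A, D (m a b) c = D b (m c a) + D a (m b c)

/-- `D : A → A*` is inner: `D(a) = a · φ - φ · a` for some `φ ∈ A*`. -/
def IsInner (m : A →L[ℂ] A →L[ℂ] A) (D : A →L[ℂ] A →L[ℂ] ℂ) : Prop :=
  ∃ φ : A →L[ℂ] ℂ, ∀ a c : A, D a c = φ (m c a) - φ (m a c)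

/-- Weak amenability: every bounded derivation `A → A*` is inner. -/
def IsWeaklyAmenable (m : A →L[ℂ] A →L[ℂ] A) : Prop :=
  ∀ D : A →L[ℂ] A →L[ℂ] ℂ, IsDerivation m D → IsInner m D

end Amenability

end WeightedOrlicz

end

/-!
The functional `D f` has density `1_U * (f̌ ξ̌)`. `D` is a derivation because `ξ` is additive:
writing `ξ x = ξ t + ξ (x - t)` in the integral `∫ f t g (x - t) dt` gives the Leibniz rule
`(f * g) ξ = (f ξ) * g + f * (g ξ)`. It is not inner because the algebra is commutative, so that
inner derivations vanish, whereas `D f` does not annihilate `1_V` when `f` is the conjugate of `ξ`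
cut off near a point with `ξ x ≠ 0` and `V` is a small neighbourhood of `-x`.

`D` is bounded because in both cases Young's inequality gives
`|ξ̃ s| x y ≤ R (Φ x Φ y + Φ x + h s + Φ y)` with `h` integrable. For `x = |f ω|(s)` and
`y = |g ω|(t)` the submultiplicativity of `ω` turns this into a bound for `|f ξ|(s) |g|(t)` on the
set `s + t ∈ U`, over which the right-hand side has a finite integral.

Since `G` need be neither second countable nor σ-compact, Borel functions of `s + t` need not be
measurable on `G × G`. Functions in `L^Φ_ω(G)` however agree almost everywhere with Baire functions
carried by σ-compact sets, and for these Fubini's theorem holds.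
-/

noncomputable section

namespace WeightedOrlicz

open scoped Pointwise

section Baire

/-- The Baire σ-algebra, generated by the continuous functions. It is what makes Fubini's theorem
available on groups that are not second countable: for a Baire function `g` the function
`(x, t) ↦ g (x - t)` is measurable for the product σ-algebra on σ-compact rectangles, whereas for
a Borel function it need not be. -/
abbrev baire (X : Type*) [TopologicalSpace X] : MeasurableSpace X :=
  ⨆ φ : C(X, ℂ), (borel ℂ).comap φ

variable {X : Type*} [TopologicalSpace X]

theorem isSigmaCompact_union {S T : Set X} (hS : IsSigmaCompact S) (hT : IsSigmaCompact T) :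
    IsSigmaCompact (S ∪ T) := by
  rw [Set.union_eq_iUnion]
  exact isSigmaCompact_iUnion _ (Bool.forall_bool.2 ⟨hT, hS⟩)

theorem measurable_baire (φ : C(X, ℂ)) : Measurable[baire X] φ := by
  rw [measurable_iff_comap_le, BorelSpace.measurable_eq (α := ℂ)]
  exact le_iSup (fun φ : C(X, ℂ) => (borel ℂ).comap φ) φ

variable [MeasurableSpace X] {μ : Measure X} {f g : X → ℂ}

/-- `f` agrees almost everywhere with a Baire function that vanishes off a σ-compact set. -/
def HasBaireRepresentative (f : X → ℂ) (μ : Measure X) : Prop :=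
  ∃ (g : X → ℂ) (S : Set X), Measurable[baire X] g ∧ IsSigmaCompact S ∧ (∀ x ∉ S, g x = 0) ∧
    f =ᵐ[μ] g

theorem hasBaireRepresentative_zero : HasBaireRepresentative (0 : X → ℂ) μ :=
  ⟨0, ∅, measurable_baire 0, isSigmaCompact_empty, fun _ _ => rfl, .rfl⟩

theorem hasBaireRepresentative_of_hasCompactSupport (φ : C(X, ℂ)) (hφ : HasCompactSupport φ) :
    HasBaireRepresentative φ μ :=
  ⟨φ, tsupport φ, measurable_baire φ, IsCompact.isSigmaCompact hφ,
    fun _ => image_eq_zero_of_notMem_tsupport, .rfl⟩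

namespace HasBaireRepresentative

theorem add (hf : HasBaireRepresentative f μ) (hg : HasBaireRepresentative g μ) :
    HasBaireRepresentative (f + g) μ := by
  obtain ⟨f', S, hf', hS, hfS, hff⟩ := hf
  obtain ⟨g', T, hg', hT, hgT, hgg⟩ := hg
  refine ⟨f' + g', S ∪ T, hf'.add hg', isSigmaCompact_union hS hT, fun x hx => ?_, hff.add hgg⟩
  rw [Pi.add_apply, hfS x fun h => hx (.inl h), hgT x fun h => hx (.inr h), add_zero]

theorem const_smul (hf : HasBaireRepresentative f μ) (c : ℂ) :
    HasBaireRepresentative (c • f) μ := by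
  obtain ⟨g, S, hg, hS, hgS, hfg⟩ := hf
  exact ⟨c • g, S, hg.const_smul c, hS, fun x hx => by simp [hgS x hx], hfg.const_smul c⟩

theorem sum {ι : Type*} {s : Finset ι} {f : ι → X → ℂ}
    (hf : ∀ i ∈ s, HasBaireRepresentative (f i) μ) : HasBaireRepresentative (∑ i ∈ s, f i) μ :=
  Finset.sum_induction _ (HasBaireRepresentative · μ) (fun _ _ => add)
    hasBaireRepresentative_zero hf

theorem of_tendsto_ae {f : ℕ → X → ℂ} (hf : ∀ n, HasBaireRepresentative (f n) μ)
    (hlim : ∀ᵐ x ∂μ, Tendsto (fun n => f n x) atTop (𝓝 (g x))) : HasBaireRepresentative g μ := by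
  choose f' S hf' hS hfS hff using hf
  set C := {x | ∃ c, Tendsto (fun n => f' n x) atTop (𝓝 c)}
  have hCm : MeasurableSet[baire X] C :=
    @measurableSet_exists_tendsto _ ℂ X (baire X) _ _ _ _ _ _ _ _ _ hf'
  have hex : ∀ x, ∃ c, Tendsto (fun n => C.indicator (f' n) x) atTop (𝓝 c) := fun x => by
    by_cases hx : x ∈ C
    · obtain ⟨c, hc⟩ : ∃ c, Tendsto (fun n => f' n x) atTop (𝓝 c) := hx
      exact ⟨c, by simpa only [Set.indicator_of_mem (show x ∈ C from ⟨c, hc⟩)] using hc⟩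
    · exact ⟨0, by simp only [Set.indicator_of_notMem hx, tendsto_const_nhds]⟩
  choose g' hg' using hex
  refine ⟨g', ⋃ n, S n, ?_, isSigmaCompact_iUnion S hS, fun x hx => ?_, ?_⟩
  · exact @measurable_of_tendsto_metrizable X ℂ (baire X) _ _ _ _ _ _
      (fun n => (hf' n).indicator hCm) (tendsto_pi_nhds.2 hg')
  · refine tendsto_nhds_unique (hg' x) (tendsto_const_nhds.congr fun n => ?_)
    rw [Set.mem_iUnion, not_exists] at hx
    exact (Set.indicator_apply_eq_zero.2 fun _ => hfS n x (hx n)).symm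
  · filter_upwards [hlim, ae_all_iff.2 hff] with x hx hffx
    have hx' : Tendsto (fun n => f' n x) atTop (𝓝 (g x)) := by simpa only [hffx] using hx
    have hxC : x ∈ C := ⟨_, hx'⟩
    exact tendsto_nhds_unique hx' (by simpa only [Set.indicator_of_mem hxC] using hg' x)

theorem of_forall_measure_ne_lt
    (hf : ∀ ε : ℝ≥0∞, ε ≠ 0 → ∃ g, HasBaireRepresentative g μ ∧ μ {x | f x ≠ g x} < ε) :
    HasBaireRepresentative f μ := by
  choose g hg hlt using fun n : ℕ => hf (2⁻¹ ^ n) (by simp)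
  refine of_tendsto_ae hg ?_
  have hsum : ∑' n, μ {x | f x ≠ g n x} ≠ ∞ := by
    refine ne_top_of_le_ne_top ?_ (ENNReal.tsum_le_tsum fun n => (hlt n).le)
    rw [ENNReal.tsum_geometric]
    simp
  filter_upwards [ae_eventually_notMem hsum] with x hx
  refine tendsto_const_nhds.congr' ?_
  filter_upwards [hx] with n hn using not_not.1 hn

end HasBaireRepresentative

variable [LocallyCompactSpace X] [T2Space X] [BorelSpace X] [μ.Regular]

theorem hasBaireRepresentative_indicator {A : Set X} (hA : MeasurableSet A) (hμA : μ A ≠ ∞) :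
    HasBaireRepresentative (A.indicator fun _ => (1 : ℂ)) μ := by
  refine .of_forall_measure_ne_lt fun ε hε => ?_
  have hε2 : ε / 2 ≠ 0 := (ENNReal.half_pos hε).ne'
  obtain ⟨K, hKA, hK, hAK⟩ := hA.exists_isCompact_sdiff_lt hμA hε2
  obtain ⟨U, hKU, hU, -, hUK⟩ :=
    hK.measurableSet.exists_isOpen_sdiff_lt (μ := μ) hK.measure_lt_top.ne hε2
  obtain ⟨φ, hφ1, hφ0, hφc, -⟩ := exists_continuous_one_zero_of_isCompact hK hU.isClosed_compl
    (Set.disjoint_compl_right_iff_subset.2 hKU)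
  refine ⟨_, hasBaireRepresentative_of_hasCompactSupport
    (⟨_, Complex.continuous_ofReal.comp φ.continuous⟩ : C(X, ℂ))
    (hφc.comp_left Complex.ofReal_zero), ?_⟩
  calc μ {x | A.indicator (fun _ => (1 : ℂ)) x ≠ φ x}
      ≤ μ (A \ K ∪ U \ K) := by
        refine measure_mono fun x hx => ?_
        by_contra hxAU
        by_cases hxK : x ∈ K
        · exact hx (by simp [hφ1 hxK, hKA hxK])
        · have hxA : x ∉ A := fun h => hxAU (.inl ⟨h, hxK⟩)
          exact hx (by simp [hφ0 fun h => hxAU (.inr ⟨h, hxK⟩), hxA])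
    _ < ε / 2 + ε / 2 := (measure_union_le _ _).trans_lt (ENNReal.add_lt_add hAK hUK)
    _ = ε := ENNReal.add_halves ε

theorem hasBaireRepresentative_simpleFunc {s : SimpleFunc X ℂ} (hs : s.FinMeasSupp μ) :
    HasBaireRepresentative s μ := by
  have hsum : ⇑s = ∑ y ∈ s.range, y • (s ⁻¹' {y}).indicator fun _ => (1 : ℂ) := by
    classical
    ext x
    simp only [Finset.sum_apply, Pi.smul_apply, Set.indicator_apply, Set.mem_preimage,
      Set.mem_singleton_iff, smul_eq_mul, mul_ite, mul_one, mul_zero, Finset.sum_ite_eq,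
      SimpleFunc.mem_range_self, if_true]
  rw [hsum]
  refine .sum fun y _ => ?_
  rcases eq_or_ne y 0 with rfl | hy
  · simpa using hasBaireRepresentative_zero
  · exact (hasBaireRepresentative_indicator (s.measurableSet_preimage {y})
      (hs.meas_preimage_singleton_ne_zero hy).ne).const_smul y

theorem hasBaireRepresentative_of_aefinStronglyMeasurable (hf : AEFinStronglyMeasurable f μ) :
    HasBaireRepresentative f μ := by
  obtain ⟨f', ⟨s, hs, hlim⟩, hff'⟩ := hf
  refine .of_tendsto_ae (fun n => hasBaireRepresentative_simpleFunc
    (SimpleFunc.finMeasSupp_iff_support.2 (hs n))) ?_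
  filter_upwards [hff'] with x hx
  simpa only [hx] using hlim x

end Baire

section Fubini

variable {α β E : Type*} [MeasurableSpace α] [MeasurableSpace β] {μ : Measure α} {ν : Measure β}

/-- A kernel `F` to which Fubini's theorem applies although `μ` and `ν` need not be σ-finite: up to
null sets, `F` is measurable for the product σ-algebra and carried by a σ-finite rectangle. Without
σ-finiteness there is no useful product measure, so the exceptional null sets are required section
by section. -/
def IsFubiniKernel [Zero E] [MeasurableSpace E] (F : α → β → E) (μ : Measure α)
    (ν : Measure β) : Prop :=
  ∃ (F' : α → β → E) (S : Set α) (T : Set β),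
    (MeasurableSet S ∧ SigmaFinite (μ.restrict S)) ∧
    (MeasurableSet T ∧ SigmaFinite (ν.restrict T)) ∧
    AEMeasurable (Function.uncurry F') ((μ.restrict S).prod (ν.restrict T)) ∧
    (∀ x y, F' x y ≠ 0 → x ∈ S ∧ y ∈ T) ∧
    (∀ᵐ x ∂μ, F x =ᵐ[ν] F' x) ∧ ∀ᵐ y ∂ν, (F · y) =ᵐ[μ] (F' · y)

theorem lintegral_ae_eq_indicator_setLIntegral {F F' : α → β → ℝ≥0∞} {S : Set α} {T : Set β}
    (hsupp : ∀ x y, F' x y ≠ 0 → x ∈ S ∧ y ∈ T) (hF : ∀ᵐ x ∂μ, F x =ᵐ[ν] F' x) :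
    (fun x => ∫⁻ y, F x y ∂ν) =ᵐ[μ] S.indicator fun x => ∫⁻ y in T, F' x y ∂ν := by
  filter_upwards [hF] with x hx
  rw [lintegral_congr_ae hx]
  by_cases hxS : x ∈ S
  · rw [Set.indicator_of_mem hxS, setLIntegral_eq_of_support_subset]
    exact fun y hy => (hsupp x y hy).2
  · simp [hxS, fun y => not_not.1 fun h => hxS (hsupp x y h).1]

theorem integral_ae_eq_indicator_setIntegral [NormedAddCommGroup E] [NormedSpace ℝ E]
    {F F' : α → β → E} {S : Set α} {T : Set β}
    (hsupp : ∀ x y, F' x y ≠ 0 → x ∈ S ∧ y ∈ T) (hF : ∀ᵐ x ∂μ, F x =ᵐ[ν] F' x) :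
    (fun x => ∫ y, F x y ∂ν) =ᵐ[μ] S.indicator fun x => ∫ y in T, F' x y ∂ν := by
  filter_upwards [hF] with x hx
  rw [integral_congr_ae hx]
  by_cases hxS : x ∈ S
  · rw [Set.indicator_of_mem hxS, setIntegral_eq_integral_of_forall_compl_eq_zero]
    exact fun y hy => not_not.1 fun h => hy (hsupp x y h).2
  · simp [hxS, fun y => not_not.1 fun h => hxS (hsupp x y h).1]

namespace IsFubiniKernel

theorem swap [Zero E] [MeasurableSpace E] {F : α → β → E} (hF : IsFubiniKernel F μ ν) :
    IsFubiniKernel (fun y x => F x y) ν μ := by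
  obtain ⟨F', S, T, ⟨hS, hSσ⟩, ⟨hT, hTσ⟩, hm, hsupp, h1, h2⟩ := hF
  exact ⟨fun y x => F' x y, T, S, ⟨hT, hTσ⟩, ⟨hS, hSσ⟩, hm.prod_swap,
    fun y x h => (hsupp x y h).symm, h2, h1⟩

theorem enorm [NormedAddCommGroup E] [MeasurableSpace E] [OpensMeasurableSpace E]
    {F : α → β → E} (hF : IsFubiniKernel F μ ν) : IsFubiniKernel (fun x y => ‖F x y‖ₑ) μ ν := by
  obtain ⟨F', S, T, hS, hT, hm, hsupp, h1, h2⟩ := hF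
  refine ⟨fun x y => ‖F' x y‖ₑ, S, T, hS, hT, hm.enorm,
    fun x y h => hsupp x y (enorm_ne_zero.1 h), ?_, ?_⟩
  · filter_upwards [h1] with x hx using hx.fun_comp _
  · filter_upwards [h2] with y hy using hy.fun_comp _

theorem mul_left [MulZeroClass E] [MeasurableSpace E] [MeasurableMul₂ E] {F : α → β → E}
    (hF : IsFubiniKernel F μ ν) {k : α → E} (hk : AEMeasurable k μ) :
    IsFubiniKernel (fun x y => k x * F x y) μ ν := by
  obtain ⟨F', S, T, hS, ⟨hT, hTσ⟩, hm, hsupp, h1, h2⟩ := hF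
  refine ⟨fun x y => k x * F' x y, S, T, hS, ⟨hT, hTσ⟩, hk.restrict.comp_fst.mul hm,
    fun x y h => hsupp x y (right_ne_zero_of_mul h), ?_, ?_⟩
  · filter_upwards [h1] with x hx using hx.fun_comp (k x * ·)
  · filter_upwards [h2] with y hy
    filter_upwards [hy] with x hx
    rw [hx]

theorem lintegral_lintegral_swap {F : α → β → ℝ≥0∞} (hF : IsFubiniKernel F μ ν) :
    ∫⁻ x, ∫⁻ y, F x y ∂ν ∂μ = ∫⁻ y, ∫⁻ x, F x y ∂μ ∂ν := by
  obtain ⟨F', S, T, ⟨hS, hSσ⟩, ⟨hT, hTσ⟩, hm, hsupp, h1, h2⟩ := hF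
  rw [lintegral_congr_ae (lintegral_ae_eq_indicator_setLIntegral hsupp h1),
    lintegral_congr_ae (lintegral_ae_eq_indicator_setLIntegral (F' := fun y x => F' x y)
      (fun y x h => (hsupp x y h).symm) h2), lintegral_indicator hS, lintegral_indicator hT]
  exact MeasureTheory.lintegral_lintegral_swap hm

theorem aemeasurable_lintegral {F : α → β → ℝ≥0∞} (hF : IsFubiniKernel F μ ν) :
    AEMeasurable (fun x => ∫⁻ y, F x y ∂ν) μ := by
  obtain ⟨F', S, T, ⟨hS, -⟩, ⟨-, hTσ⟩, hm, hsupp, h1, -⟩ := hF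
  refine AEMeasurable.congr ?_ (lintegral_ae_eq_indicator_setLIntegral hsupp h1).symm
  exact (aemeasurable_indicator_iff hS).2 hm.lintegral_prod_right'

variable [NormedAddCommGroup E] [NormedSpace ℝ E] [MeasurableSpace E] [BorelSpace E]
  [SecondCountableTopology E] {F : α → β → E}

theorem aestronglyMeasurable_integral (hF : IsFubiniKernel F μ ν) :
    AEStronglyMeasurable (fun x => ∫ y, F x y ∂ν) μ := by
  obtain ⟨F', S, T, ⟨hS, -⟩, ⟨-, hTσ⟩, hm, hsupp, h1, -⟩ := hF
  refine AEStronglyMeasurable.congr ?_ (integral_ae_eq_indicator_setIntegral hsupp h1).symm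
  exact (aestronglyMeasurable_indicator_iff hS).2 hm.aestronglyMeasurable.integral_prod_right'

theorem integral_integral_swap (hF : IsFubiniKernel F μ ν)
    (hfin : ∫⁻ x, ∫⁻ y, ‖F x y‖ₑ ∂ν ∂μ < ∞) :
    ∫ x, ∫ y, F x y ∂ν ∂μ = ∫ y, ∫ x, F x y ∂μ ∂ν := by
  obtain ⟨F', S, T, ⟨hS, hSσ⟩, ⟨hT, hTσ⟩, hm, hsupp, h1, h2⟩ := hF
  have hint : Integrable (Function.uncurry F') ((μ.restrict S).prod (ν.restrict T)) := by
    refine ⟨hm.aestronglyMeasurable, ?_⟩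
    rw [hasFiniteIntegral_iff_enorm, lintegral_prod _ hm.enorm]
    rwa [lintegral_congr_ae (lintegral_ae_eq_indicator_setLIntegral
      (F := fun x y => ‖F x y‖ₑ) (F' := fun x y => ‖F' x y‖ₑ)
      (fun x y h => hsupp x y (enorm_ne_zero.1 h)) (h1.mono fun x hx => hx.fun_comp (‖·‖ₑ))),
      lintegral_indicator hS] at hfin
  rw [integral_congr_ae (integral_ae_eq_indicator_setIntegral hsupp h1),
    integral_congr_ae (integral_ae_eq_indicator_setIntegral (F' := fun y x => F' x y)
      (fun y x h => (hsupp x y h).symm) h2), integral_indicator hS, integral_indicator hT]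
  exact MeasureTheory.integral_integral_swap hint

end IsFubiniKernel

end Fubini

section SigmaCompact

theorem isSigmaCompact_add {G : Type*} [AddGroup G] [TopologicalSpace G] [ContinuousAdd G]
    {S T : Set G} (hS : IsSigmaCompact S) (hT : IsSigmaCompact T) :
    IsSigmaCompact (S + T) := by
  obtain ⟨K, hK, rfl⟩ := hS
  obtain ⟨L, hL, rfl⟩ := hT
  simp only [Set.iUnion_add, Set.add_iUnion]
  exact isSigmaCompact_iUnion _ fun i =>
    isSigmaCompact_iUnion_of_isCompact _ fun j => (hK j).add (hL i)

variable {X : Type*} [TopologicalSpace X] [T2Space X] {S : Set X}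

theorem exists_continuous_eventually_eq_one [LocallyCompactSpace X] (hS : IsSigmaCompact S) :
    ∃ ψ : ℕ → C(X, ℝ), (∀ n, HasCompactSupport (ψ n)) ∧
      ∀ x ∈ S, ∀ᶠ n in atTop, ψ n x = 1 := by
  obtain ⟨K, hK, rfl⟩ := hS
  choose ψ hψ _ hc _ using fun n => exists_continuous_one_zero_of_isCompact
    ((Set.finite_Iic n).isCompact_biUnion fun k _ => hK k) isClosed_empty (Set.disjoint_empty _)
  refine ⟨ψ, hc, fun x hx => ?_⟩
  obtain ⟨i, hi⟩ := Set.mem_iUnion.1 hx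
  filter_upwards [eventually_ge_atTop i] with n hn
  exact hψ n (Set.mem_biUnion (Set.mem_Iic.2 hn) hi)

variable [MeasurableSpace X] [BorelSpace X]

theorem measurableSet_of_isSigmaCompact (hS : IsSigmaCompact S) : MeasurableSet S := by
  obtain ⟨K, hK, rfl⟩ := hS
  exact MeasurableSet.iUnion fun n => (hK n).measurableSet

theorem sigmaFinite_restrict_of_isSigmaCompact {μ : Measure X} [IsFiniteMeasureOnCompacts μ]
    (hS : IsSigmaCompact S) : SigmaFinite (μ.restrict S) := by
  have hSm := measurableSet_of_isSigmaCompact hS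
  obtain ⟨K, hK, rfl⟩ := hS
  refine ⟨⟨⟨fun n => K n ∪ (⋃ n, K n)ᶜ, fun _ => trivial, fun n => ?_, ?_⟩⟩⟩
  · rw [Measure.restrict_apply' hSm, Set.union_inter_distrib_right, Set.compl_inter_self,
      Set.union_empty]
    exact (measure_mono Set.inter_subset_left).trans_lt (hK n).measure_lt_top
  · rw [← Set.iUnion_union, Set.union_compl_self]

end SigmaCompact

section BaireKernel

variable {X Y Z : Type*} [TopologicalSpace X] [TopologicalSpace Y] [TopologicalSpace Z]
  [T2Space X] [LocallyCompactSpace X] [MeasurableSpace X] [BorelSpace X]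
  [T2Space Y] [LocallyCompactSpace Y] [MeasurableSpace Y] [BorelSpace Y]
  {μ : Measure X} {ν : Measure Y} [IsFiniteMeasureOnCompacts ν] {S : Set X} {T : Set Y}

theorem aemeasurable_prod_restrict_of_continuous (hS : IsSigmaCompact S) (hT : IsSigmaCompact T)
    {φ : X × Y → ℂ} (hφ : Continuous φ) :
    AEMeasurable φ ((μ.restrict S).prod (ν.restrict T)) := by
  have := sigmaFinite_restrict_of_isSigmaCompact (μ := ν) hT
  obtain ⟨ψ, hψc, hψ⟩ := exists_continuous_eventually_eq_one hS
  obtain ⟨χ, hχc, hχ⟩ := exists_continuous_eventually_eq_one hT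
  refine aemeasurable_of_tendsto_metrizable_ae atTop
    (f := fun n p => (ψ n p.1 * χ n p.2) • φ p) (fun n => ?_) ?_
  · refine (HasCompactSupport.stronglyMeasurable_of_prod (by fun_prop) ?_).measurable.aemeasurable
    refine HasCompactSupport.intro ((hψc n).prod (hχc n)) fun p hp => ?_
    rcases not_and_or.1 hp with h | h <;> simp [image_eq_zero_of_notMem_tsupport h]
  · filter_upwards [Measure.quasiMeasurePreserving_fst.ae
        (ae_restrict_mem (measurableSet_of_isSigmaCompact hS)),
      Measure.quasiMeasurePreserving_snd.ae
        (ae_restrict_mem (measurableSet_of_isSigmaCompact hT))] with p h1 h2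
    refine tendsto_const_nhds.congr' ?_
    filter_upwards [hψ _ h1, hχ _ h2] with n h1 h2
    rw [h1, h2, mul_one, one_smul]

theorem aemeasurable_comp_prod_restrict_of_baire (hS : IsSigmaCompact S) (hT : IsSigmaCompact T)
    {π : X × Y → Z} (hπ : Continuous π) {g : Z → ℂ} (hg : Measurable[baire Z] g) :
    AEMeasurable (fun p => g (π p)) ((μ.restrict S).prod (ν.restrict T)) := by
  refine NullMeasurable.aemeasurable fun s hs => ?_
  have hle : baire Z ≤ MeasurableSpace.map π (inferInstanceAs (MeasurableSpace
      (NullMeasurableSpace (X × Y) ((μ.restrict S).prod (ν.restrict T))))) := by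
    refine iSup_le fun φ => ?_
    rw [← BorelSpace.measurable_eq (α := ℂ)]
    rintro _ ⟨t, ht, rfl⟩
    exact (aemeasurable_prod_restrict_of_continuous hS hT (φ.continuous.comp hπ)).nullMeasurable ht
  exact hle _ (hg hs)

end BaireKernel

section Convolution

theorem integral_mul_mul_comp_sub {G : Type*} [AddGroup G] [MeasurableSpace G] [MeasurableAdd G]
    {μ : Measure G} [μ.IsAddRightInvariant] (f g k : G → ℂ) (t : G) :
    ∫ x, k x * (f t * g (x - t)) ∂μ = f t * ∫ x, k (x + t) * g x ∂μ := by
  rw [← integral_const_mul, ← integral_sub_right_eq_self (fun x => f t * (k (x + t) * g x)) t]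
  simp only [sub_add_cancel, mul_left_comm]

variable {G : Type*} [AddCommGroup G] [TopologicalSpace G] [IsTopologicalAddGroup G]
  [LocallyCompactSpace G] [T2Space G] [MeasurableSpace G] [BorelSpace G]
  {μ : Measure G} [μ.IsAddHaarMeasure] [μ.Regular] {f g : G → ℂ}

theorem isFubiniKernel_convolution (hf : AEFinStronglyMeasurable f μ)
    (hg : AEFinStronglyMeasurable g μ) : IsFubiniKernel (fun x t => f t * g (x - t)) μ μ := by
  obtain ⟨f', S, -, hS, hfS, hff⟩ := hasBaireRepresentative_of_aefinStronglyMeasurable hf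
  obtain ⟨g', T, hg', hT, hgT, hgg⟩ := hasBaireRepresentative_of_aefinStronglyMeasurable hg
  have hST := isSigmaCompact_add hS hT
  have := sigmaFinite_restrict_of_isSigmaCompact (μ := μ) hS
  refine ⟨fun x t => f' t * g' (x - t), S + T, S,
    ⟨measurableSet_of_isSigmaCompact hST, sigmaFinite_restrict_of_isSigmaCompact hST⟩,
    ⟨measurableSet_of_isSigmaCompact hS, this⟩, ?_, fun x t h => ?_, .of_forall fun x => ?_, ?_⟩
  · exact (hf.aemeasurable.congr hff).restrict.comp_snd.mul
      (aemeasurable_comp_prod_restrict_of_baire hST hS (by fun_prop) hg')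
  · have ht : t ∈ S := not_not.1 fun ht => left_ne_zero_of_mul h (hfS t ht)
    have hxt : x - t ∈ T := not_not.1 fun hxt => right_ne_zero_of_mul h (hgT _ hxt)
    exact ⟨⟨t, ht, x - t, hxt, add_sub_cancel t x⟩, ht⟩
  · filter_upwards [hff,
      (Measure.measurePreserving_sub_left μ x).quasiMeasurePreserving.ae hgg] with t h1 h2
    rw [h1, h2]
  · filter_upwards [hff] with t ht
    filter_upwards [(measurePreserving_sub_right μ t).quasiMeasurePreserving.ae hgg] with x hx
    rw [ht, hx]

theorem lintegral_mul_lconvolution (hf : AEFinStronglyMeasurable f μ)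
    (hg : AEFinStronglyMeasurable g μ) {k : G → ℝ≥0∞} (hk : AEMeasurable k μ) :
    ∫⁻ x, k x * ∫⁻ t, ‖f t‖ₑ * ‖g (x - t)‖ₑ ∂μ ∂μ
      = ∫⁻ t, ‖f t‖ₑ * ∫⁻ x, k (x + t) * ‖g x‖ₑ ∂μ ∂μ := by
  have hF := isFubiniKernel_convolution hf hg
  have hgm := hg.aemeasurable.enorm
  calc ∫⁻ x, k x * ∫⁻ t, ‖f t‖ₑ * ‖g (x - t)‖ₑ ∂μ ∂μ
      = ∫⁻ x, ∫⁻ t, k x * ‖f t * g (x - t)‖ₑ ∂μ ∂μ := by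
        refine lintegral_congr fun x => ?_
        have hgx : AEMeasurable (fun t => ‖g (x - t)‖ₑ) μ := hgm.comp_quasiMeasurePreserving
          (Measure.measurePreserving_sub_left μ x).quasiMeasurePreserving
        simp only [enorm_mul]
        exact (lintegral_const_mul'' (k x) (hf.aemeasurable.enorm.mul hgx)).symm
    _ = ∫⁻ t, ∫⁻ x, k x * ‖f t * g (x - t)‖ₑ ∂μ ∂μ :=
        (hF.enorm.mul_left hk).lintegral_lintegral_swap
    _ = _ := by
        refine lintegral_congr fun t => ?_
        rw [← lintegral_const_mul' _ _ enorm_ne_top,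
          ← lintegral_sub_right_eq_self (fun x => ‖f t‖ₑ * (k (x + t) * ‖g x‖ₑ)) t]
        simp only [sub_add_cancel, enorm_mul, mul_left_comm]

variable {k : G → ℂ}

theorem integral_mul_convolution (hf : AEFinStronglyMeasurable f μ)
    (hg : AEFinStronglyMeasurable g μ) (hk : AEMeasurable k μ)
    (hfin : ∫⁻ t, ‖f t‖ₑ * ∫⁻ x, ‖k (x + t)‖ₑ * ‖g x‖ₑ ∂μ ∂μ < ∞) :
    ∫ x, k x * ∫ t, f t * g (x - t) ∂μ ∂μ = ∫ t, f t * ∫ x, k (x + t) * g x ∂μ ∂μ := by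
  have hF := (isFubiniKernel_convolution hf hg).mul_left hk
  rw [← lintegral_mul_lconvolution hf hg hk.enorm] at hfin
  calc ∫ x, k x * ∫ t, f t * g (x - t) ∂μ ∂μ
      = ∫ x, ∫ t, k x * (f t * g (x - t)) ∂μ ∂μ := by simp only [integral_const_mul]
    _ = ∫ t, ∫ x, k x * (f t * g (x - t)) ∂μ ∂μ := by
        refine hF.integral_integral_swap (lt_of_le_of_lt (lintegral_mono fun x => ?_) hfin)
        simp only [enorm_mul]
        exact (lintegral_const_mul' _ _ enorm_ne_top).le
    _ = _ := by simp only [integral_mul_mul_comp_sub]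

theorem integrable_mul_integral_comp_add_mul (hf : AEFinStronglyMeasurable f μ)
    (hg : AEFinStronglyMeasurable g μ) (hk : AEMeasurable k μ)
    (hfin : ∫⁻ t, ‖f t‖ₑ * ∫⁻ x, ‖k (x + t)‖ₑ * ‖g x‖ₑ ∂μ ∂μ < ∞) :
    Integrable (fun t => f t * ∫ x, k (x + t) * g x ∂μ) μ := by
  constructor
  · simp only [← integral_mul_mul_comp_sub]
    exact ((isFubiniKernel_convolution hf hg).mul_left hk).swap.aestronglyMeasurable_integral
  · refine hasFiniteIntegral_iff_enorm.2 (lt_of_le_of_lt (lintegral_mono fun t => ?_) hfin)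
    simp only [enorm_mul]
    gcongr
    exact (enorm_integral_le_lintegral_enorm _).trans_eq (by simp only [enorm_mul])

theorem aemeasurable_lconvolution (hf : AEFinStronglyMeasurable f μ)
    (hg : AEFinStronglyMeasurable g μ) :
    AEMeasurable (fun x => ∫⁻ t, ‖f t‖ₑ * ‖g (x - t)‖ₑ ∂μ) μ := by
  simpa only [enorm_mul] using (isFubiniKernel_convolution hf hg).enorm.aemeasurable_lintegral

theorem aestronglyMeasurable_convolution (hf : AEFinStronglyMeasurable f μ)
    (hg : AEFinStronglyMeasurable g μ) :
    AEStronglyMeasurable (fun x => ∫ t, f t * g (x - t) ∂μ) μ :=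
  (isFubiniKernel_convolution hf hg).aestronglyMeasurable_integral

end Convolution

section YoungFunction

variable {Φ : ℝ≥0 → ℝ≥0∞}

namespace IsYoung

theorem map_mul_le (hΦ : IsYoung Φ) {a : ℝ≥0} (ha : a ≤ 1) (x : ℝ≥0) :
    Φ (a * x) ≤ a * Φ x := by
  simpa [hΦ.map_zero, ENNReal.smul_def] using
    hΦ.convex.2 (Set.mem_univ x) (Set.mem_univ 0) a.2 (1 - a).2 (add_tsub_cancel_of_le ha)

theorem monotone (hΦ : IsYoung Φ) : Monotone Φ := by
  intro x y hxy
  have hle : x / y ≤ 1 := div_le_one_of_le₀ hxy y.2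
  calc Φ x = Φ (x / y * y) := by rw [div_mul_cancel_of_imp fun hy => by simpa [hy] using hxy]
    _ ≤ (x / y : ℝ≥0) * Φ y := hΦ.map_mul_le hle y
    _ ≤ 1 * Φ y := by gcongr; exact_mod_cast hle
    _ = Φ y := one_mul _

theorem convexOn_toReal (hΦ : IsYoung Φ) (hfin : ∀ x, Φ x ≠ ∞) :
    ConvexOn ℝ Set.univ fun r : ℝ => (Φ r.toNNReal).toReal := by
  refine ⟨convex_univ, fun x _ y _ a b ha hb hab => ?_⟩
  lift a to ℝ≥0 using ha
  lift b to ℝ≥0 using hb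
  have hle : ((a : ℝ) • x + (b : ℝ) • y).toNNReal ≤ a • x.toNNReal + b • y.toNNReal := by
    rw [Real.toNNReal_le_iff_le_coe]
    simp only [smul_eq_mul, NNReal.coe_add, NNReal.coe_mul]
    gcongr <;> exact Real.le_coe_toNNReal _
  have hconv : Φ ((a : ℝ) • x + (b : ℝ) • y).toNNReal
      ≤ a * Φ x.toNNReal + b * Φ y.toNNReal :=
    (hΦ.monotone hle).trans <| hΦ.convex.2 (Set.mem_univ _) (Set.mem_univ _) a.2 b.2
      (by exact_mod_cast hab)
  have hx : a * Φ x.toNNReal ≠ ∞ := ENNReal.mul_ne_top ENNReal.coe_ne_top (hfin _)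
  have hy : b * Φ y.toNNReal ≠ ∞ := ENNReal.mul_ne_top ENNReal.coe_ne_top (hfin _)
  simpa [ENNReal.toReal_add hx hy] using ENNReal.toReal_mono (ENNReal.add_ne_top.2 ⟨hx, hy⟩) hconv

theorem le_sq_mul (hΦ : IsYoung fun x => Φ (NNReal.sqrt x)) {y : ℝ≥0} (hy : y ≤ 1) :
    Φ y ≤ (y ^ 2 : ℝ≥0) * Φ 1 := by
  simpa using hΦ.map_mul_le (pow_le_one₀ (n := 2) y.2 hy) 1

end IsYoung

theorem exists_affine_le_of_convexOn {φ : ℝ → ℝ} (hφ : ConvexOn ℝ Set.univ φ) (x : ℝ) :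
    ∃ c : ℝ, ∀ z, φ x + c * (z - x) ≤ φ z := by
  have hx : x ∈ interior (Set.univ : Set ℝ) := by simp
  refine ⟨derivWithin φ (Set.Ioi x) x, fun z => ?_⟩
  rcases lt_trichotomy x z with h | rfl | h
  · have hslope := hφ.rightDeriv_le_slope_of_mem_interior hx (Set.mem_univ z) h
    rw [slope_def_field, le_div_iff₀ (sub_pos.2 h)] at hslope
    linarith
  · simp
  · have hslope := (hφ.slope_le_leftDeriv_of_mem_interior (Set.mem_univ z) hx h).trans
      (hφ.leftDeriv_le_rightDeriv_of_mem_interior hx)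
    rw [slope_def_field, div_le_iff₀ (sub_pos.2 h)] at hslope
    linarith

theorem IsYoung.exists_add_complementary_le (hΦ : IsYoung Φ) (hfin : ∀ x, Φ x ≠ ∞) (x : ℝ≥0) :
    ∃ y : ℝ≥0, Φ x + complementary Φ y ≤ (x * y : ℝ≥0) := by
  lift Φ to ℝ≥0 → ℝ≥0 using hfin
  obtain ⟨c, hc⟩ := exists_affine_le_of_convexOn (hΦ.convexOn_toReal fun _ => ENNReal.coe_ne_top) x
  simp only [Real.toNNReal_coe, ENNReal.coe_toReal] at hc
  have hc0 : 0 ≤ c := by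
    have hle : Φ ((x : ℝ) - 1).toNNReal ≤ Φ x := by
      exact_mod_cast hΦ.monotone (Real.toNNReal_le_iff_le_coe.2 (by linarith : (x : ℝ) - 1 ≤ x))
    linarith [hc (x - 1), NNReal.coe_le_coe.2 hle]
  lift c to ℝ≥0 using hc0
  have hsub (z : ℝ≥0) : Φ x + z * c ≤ x * c + Φ z := by
    have hz := hc z
    rw [Real.toNNReal_coe] at hz
    exact_mod_cast (by linarith : (Φ x + z * c : ℝ) ≤ x * c + Φ z)
  refine ⟨c, ?_⟩
  rw [complementary, ENNReal.add_iSup]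
  refine iSup_le fun z => ?_
  rcases le_total (z * c) (Φ z) with h | h
  · rw [tsub_eq_zero_of_le (ENNReal.coe_le_coe.2 h), add_zero]
    have hΦ0 : Φ 0 = 0 := by exact_mod_cast hΦ.map_zero
    exact ENNReal.coe_le_coe.2 (by simpa [hΦ0] using hsub 0)
  · rw [← ENNReal.coe_sub, ← ENNReal.coe_add, ENNReal.coe_le_coe, ← add_tsub_assoc_of_le h]
    exact tsub_le_iff_right.2 (hsub z)

theorem exists_min_sq_le_mul {c : ℝ≥0} (hc : ∀ y ≤ 1, complementary Φ y ≤ (c * y ^ 2 : ℝ≥0)) :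
    ∃ C : ℝ≥0, ∀ x : ℝ≥0, (min x (x ^ 2) : ℝ≥0) ≤ C * Φ x := by
  refine ⟨2 * (2 * c + 1), fun x => ?_⟩
  by_cases hx : Φ x = ∞
  · rw [hx, ENNReal.mul_top (by simp)]
    exact le_top
  lift Φ x to ℝ≥0 using hx with p hp
  have hy : min x 1 / (2 * c + 1) ≤ 1 :=
    div_le_one_of_le₀ ((min_le_right _ _).trans (by simp)) zero_le
  have hyoung : x * (min x 1 / (2 * c + 1)) ≤ p + c * (min x 1 / (2 * c + 1)) ^ 2 := by
    have h := (young_inequality Φ x _).trans (add_le_add_right (hc _ hy) _)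
    rw [← hp] at h
    exact_mod_cast h
  have hmul : x * min x 1 = min x (x ^ 2) := by
    rcases le_total x 1 with h | h
    · rw [min_eq_left h, min_eq_right (pow_le_of_le_one zero_le h two_ne_zero), sq]
    · rw [min_eq_right h, min_eq_left (le_self_pow h two_ne_zero), mul_one]
  have hsq : min x 1 ^ 2 ≤ min x (x ^ 2) := by
    rw [← hmul, sq]
    gcongr
    exact min_le_left _ _
  rw [← mul_div_assoc, hmul, div_pow, ← mul_div_assoc, ← NNReal.coe_le_coe] at hyoung
  rw [← NNReal.coe_le_coe] at hsq
  norm_cast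
  rw [← NNReal.coe_le_coe]
  generalize min x (x ^ 2) = M at *
  push_cast at hyoung hsq ⊢
  have hd : (0 : ℝ) < 2 * c + 1 := by positivity
  field_simp at hyoung
  refine le_of_mul_le_mul_right ?_ hd
  nlinarith [mul_le_mul_of_nonneg_left hsq c.2, M.2]

end YoungFunction

namespace YoungPair

variable (P : YoungPair)

theorem Φ_ne_top (x : ℝ≥0) : P.Φ x ≠ ∞ :=
  ((P.strictMono_Φ (lt_add_one x)).trans_le le_top).ne

theorem Ψ_ne_top (x : ℝ≥0) : P.Ψ x ≠ ∞ :=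
  ((P.strictMono_Ψ (lt_add_one x)).trans_le le_top).ne

theorem young (x y : ℝ≥0) : (x * y : ℝ≥0) ≤ P.Φ x + P.Ψ y :=
  P.compl_eq ▸ young_inequality P.Φ x y

theorem exists_young_eq (x : ℝ≥0) : ∃ y : ℝ≥0, P.Φ x + P.Ψ y = (x * y : ℝ≥0) := by
  obtain ⟨y, hy⟩ := P.young_Φ.exists_add_complementary_le P.Φ_ne_top x
  exact ⟨y, le_antisymm (P.compl_eq ▸ hy) (P.young x y)⟩

theorem exists_min_sq_le_mul_Φ {c : ℝ≥0} (hc : ∀ y ≤ 1, P.Ψ y ≤ c * y ^ 2) :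
    ∃ C : ℝ≥0, ∀ x : ℝ≥0, (min x (x ^ 2) : ℝ≥0) ≤ C * P.Φ x :=
  exists_min_sq_le_mul fun y hy => by
    rw [← P.compl_eq]
    exact_mod_cast hc y hy

end YoungPair

section Orlicz

variable {α : Type*} [MeasurableSpace α] {μ : Measure α}

theorem lintegral_mul_le_max_mul_eOrliczNorm {Ψ : ℝ≥0 → ℝ≥0∞} (hΨ : IsYoung Ψ) (f : α → ℂ)
    {v : α → ℝ≥0} (hv : Measurable v) (hvΨ : ∫⁻ x, Ψ (v x) ∂μ ≠ ∞) :
    ∫⁻ x, ‖f x‖ₑ * v x ∂μ ≤ max 1 (∫⁻ x, Ψ (v x) ∂μ) * eOrliczNorm Ψ f μ := by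
  lift ∫⁻ x, Ψ (v x) ∂μ to ℝ≥0 using hvΨ with N hN
  set R : ℝ≥0 := max 1 N with hR
  have hR0 : R ≠ 0 := (zero_lt_one.trans_le (le_max_left 1 N)).ne'
  set w : α → ℂ := fun x => ((R⁻¹ * v x : ℝ≥0) : ℝ)
  have hw (x : α) : ‖w x‖₊ = R⁻¹ * v x := by ext; simp [w]
  have hwΨ : ∫⁻ x, Ψ ‖w x‖₊ ∂μ ≤ 1 := by
    calc ∫⁻ x, Ψ ‖w x‖₊ ∂μ ≤ ∫⁻ x, (R⁻¹ : ℝ≥0) * Ψ (v x) ∂μ := lintegral_mono fun x => by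
          rw [hw]
          exact hΨ.map_mul_le (inv_le_one_of_one_le₀ (le_max_left 1 N)) _
      _ = (R⁻¹ * N : ℝ≥0) := by rw [lintegral_const_mul' _ _ ENNReal.coe_ne_top, ← hN]; simp
      _ ≤ 1 := by
          rw [← ENNReal.coe_one, ENNReal.coe_le_coe, inv_mul_le_iff₀ (by positivity), mul_one]
          exact le_max_right 1 N
  have hwm : AEStronglyMeasurable w μ :=
    (Complex.measurable_ofReal.comp (hv.const_mul R⁻¹).coe_nnreal_real).aestronglyMeasurable
  calc ∫⁻ x, ‖f x‖ₑ * v x ∂μ = ∫⁻ x, R * ‖f x * w x‖ₑ ∂μ := lintegral_congr fun x => by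
        rw [enorm_mul, enorm_eq_nnnorm (w x), hw, mul_left_comm, ← ENNReal.coe_mul,
          mul_inv_cancel_left₀ hR0]
    _ = R * ∫⁻ x, ‖f x * w x‖ₑ ∂μ := lintegral_const_mul' _ _ ENNReal.coe_ne_top
    _ ≤ R * eOrliczNorm Ψ f μ := by
        gcongr
        exact le_iSup₂_of_le w hwm (le_iSup_of_le hwΨ le_rfl)
    _ = max 1 (N : ℝ≥0∞) * eOrliczNorm Ψ f μ := by rw [hR, ENNReal.coe_max, ENNReal.coe_one]

theorem exists_simpleFunc_le_tendsto {u : α → ℝ≥0} (hu : Measurable u) :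
    ∃ s : ℕ → SimpleFunc α ℝ≥0, (∀ n x, s n x ≤ u x) ∧
      ∀ x, Tendsto (fun n => s n x) atTop (𝓝 (u x)) := by
  refine ⟨fun n => (SimpleFunc.eapprox (fun x => (u x : ℝ≥0∞)) n).map ENNReal.toNNReal,
    fun n x => ENNReal.toNNReal_mono ENNReal.coe_ne_top ?_, fun x =>
    (ENNReal.tendsto_toNNReal ENNReal.coe_ne_top).comp
      (SimpleFunc.tendsto_eapprox hu.coe_nnreal_ennreal x)⟩
  rw [← SimpleFunc.iSup_eapprox_apply hu.coe_nnreal_ennreal x]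
  exact le_iSup (fun n => SimpleFunc.eapprox (fun x => (u x : ℝ≥0∞)) n x) n

variable (P : YoungPair)

theorem lintegral_Φ_simpleFunc_le_one {f : α → ℂ} (hf : eOrliczNorm P.Ψ f μ ≤ 1)
    {s : SimpleFunc α ℝ≥0} (hs : ∀ᵐ x ∂μ, s x ≤ ‖f x‖₊) (hfin : s.FinMeasSupp μ) :
    ∫⁻ x, P.Φ (s x) ∂μ ≤ 1 := by
  choose y hy using P.exists_young_eq
  have hy0 : P.Ψ (y 0) = 0 := by
    have h := hy 0
    rw [zero_mul, ENNReal.coe_zero, add_eq_zero] at h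
    exact h.2
  have hΨtop : ∫⁻ x, P.Ψ (y (s x)) ∂μ ≠ ∞ := by
    rw [show (fun x => P.Ψ (y (s x))) = s.map fun r => P.Ψ (y r) from rfl,
      SimpleFunc.lintegral_eq_lintegral]
    exact ((hfin.map (g := fun r => P.Ψ (y r)) hy0).lintegral_lt_top
      (Eventually.of_forall fun _ => P.Ψ_ne_top _)).ne
  have hsum : ∫⁻ x, P.Φ (s x) ∂μ + ∫⁻ x, P.Ψ (y (s x)) ∂μ ≤ max 1 (∫⁻ x, P.Ψ (y (s x)) ∂μ) := by
    calc ∫⁻ x, P.Φ (s x) ∂μ + ∫⁻ x, P.Ψ (y (s x)) ∂μ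
        = ∫⁻ x, P.Φ (s x) + P.Ψ (y (s x)) ∂μ :=
          (lintegral_add_left (P.continuous_Φ.measurable.comp s.measurable) _).symm
      _ ≤ ∫⁻ x, ‖f x‖ₑ * y (s x) ∂μ := by
          refine lintegral_mono_ae (hs.mono fun x hx => ?_)
          rw [hy, enorm_eq_nnnorm, ← ENNReal.coe_mul]
          gcongr
      _ ≤ max 1 (∫⁻ x, P.Ψ (y (s x)) ∂μ) * eOrliczNorm P.Ψ f μ :=
          lintegral_mul_le_max_mul_eOrliczNorm P.young_Ψ f (s.map y).measurable hΨtop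
      _ ≤ max 1 (∫⁻ x, P.Ψ (y (s x)) ∂μ) := mul_le_of_le_one_right' hf
  rcases le_total (∫⁻ x, P.Ψ (y (s x)) ∂μ) 1 with h | h
  · exact le_self_add.trans (hsum.trans (max_eq_left h).le)
  · rw [max_eq_right h] at hsum
    exact ((ENNReal.add_le_add_iff_right hΨtop).1 (hsum.trans (zero_add _).ge)).trans zero_le_one

theorem MemOrlicz.lintegral_Φ_le_one {f : α → ℂ} (hf : MemOrlicz P.Φ f μ)
    (hn : eOrliczNorm P.Ψ f μ ≤ 1) : ∫⁻ x, P.Φ ‖f x‖₊ ∂μ ≤ 1 := by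
  obtain ⟨hfm, a, ha, hfi⟩ := hf
  have hum : AEMeasurable (fun x => ‖f x‖₊) μ := hfm.nnnorm.aemeasurable
  obtain ⟨s, hsu, hlim⟩ := exists_simpleFunc_le_tendsto hum.measurable_mk
  have hsf (n : ℕ) : ∀ᵐ x ∂μ, s n x ≤ ‖f x‖₊ := by
    filter_upwards [hum.ae_eq_mk] with x hx
    rw [hx]
    exact hsu n x
  have hsupp (n : ℕ) : (s n).FinMeasSupp μ := by
    have hlt : ((s n).map fun r => P.Φ (a * r)).lintegral μ ≠ ∞ := by
      rw [← SimpleFunc.lintegral_eq_lintegral]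
      refine ((lintegral_mono_ae ((hsf n).mono fun x hx => ?_)).trans_lt hfi).ne
      exact P.strictMono_Φ.monotone (mul_le_mul_right hx a)
    refine (SimpleFunc.FinMeasSupp.of_lintegral_ne_top hlt).of_map fun r hr => ?_
    rw [← P.young_Φ.map_zero, P.strictMono_Φ.injective.eq_iff, mul_eq_zero] at hr
    exact hr.resolve_left ha.ne'
  calc ∫⁻ x, P.Φ ‖f x‖₊ ∂μ = ∫⁻ x, liminf (fun n => P.Φ (s n x)) atTop ∂μ := by
        refine lintegral_congr_ae (hum.ae_eq_mk.mono fun x hx => ?_)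
        beta_reduce at hx ⊢
        rw [hx]
        exact ((P.continuous_Φ.tendsto _).comp (hlim x)).liminf_eq.symm
    _ ≤ liminf (fun n => ∫⁻ x, P.Φ (s n x) ∂μ) atTop :=
        lintegral_liminf_le fun n => P.continuous_Φ.measurable.comp (s n).measurable
    _ ≤ 1 := liminf_le_of_frequently_le' <| Frequently.of_forall fun n =>
        lintegral_Φ_simpleFunc_le_one P hn (hsf n) (hsupp n)

theorem eOrliczNorm_le_lintegral_Φ_add_one {f : α → ℂ} (hf : AEStronglyMeasurable f μ) :
    eOrliczNorm P.Ψ f μ ≤ ∫⁻ x, P.Φ ‖f x‖₊ ∂μ + 1 := by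
  refine iSup_le fun v => iSup_le fun _ => iSup_le fun hvΨ => ?_
  calc ∫⁻ x, ‖f x * v x‖ₑ ∂μ ≤ ∫⁻ x, P.Φ ‖f x‖₊ + P.Ψ ‖v x‖₊ ∂μ := lintegral_mono fun x => by
        simpa [enorm_eq_nnnorm] using P.young ‖f x‖₊ ‖v x‖₊
    _ = ∫⁻ x, P.Φ ‖f x‖₊ ∂μ + ∫⁻ x, P.Ψ ‖v x‖₊ ∂μ :=
        lintegral_add_left' (P.continuous_Φ.measurable.comp_aemeasurable hf.nnnorm.aemeasurable) _
    _ ≤ ∫⁻ x, P.Φ ‖f x‖₊ ∂μ + 1 := by gcongr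

theorem memOrlicz_of_bounded {f : α → ℂ} (hf : AEStronglyMeasurable f μ) {E : Set α}
    (hE : MeasurableSet E) (hμE : μ E ≠ ∞) {M : ℝ≥0}
    (hM : ∀ᵐ x ∂μ, ‖f x‖₊ ≤ E.indicator (fun _ => M) x) : MemOrlicz P.Φ f μ := by
  refine ⟨hf, 1, one_pos, ?_⟩
  calc ∫⁻ x, P.Φ (1 * ‖f x‖₊) ∂μ ≤ ∫⁻ x, E.indicator (fun _ => P.Φ M) x ∂μ := by
        refine lintegral_mono_ae (hM.mono fun x hx => ?_)
        rw [one_mul]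
        refine (P.strictMono_Φ.monotone hx).trans_eq ?_
        exact congrFun (E.indicator_comp_of_zero P.young_Φ.map_zero).symm x
    _ = P.Φ M * μ E := lintegral_indicator_const hE _
    _ < ∞ := ENNReal.mul_lt_top (P.Φ_ne_top M).lt_top hμE.lt_top

theorem MemOrlicz.measure_ne_top {E : Set α} (hE : MeasurableSet E)
    (h : MemOrlicz P.Φ (E.indicator fun _ => (1 : ℂ)) μ) : μ E ≠ ∞ := by
  obtain ⟨-, a, ha, hi⟩ := h
  have hle : P.Φ a * μ E ≤ ∫⁻ x, P.Φ (a * ‖E.indicator (fun _ => (1 : ℂ)) x‖₊) ∂μ := by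
    rw [← lintegral_indicator_const hE]
    refine lintegral_mono fun x => ?_
    by_cases hx : x ∈ E <;> simp [hx]
  have hΦa : P.Φ a ≠ 0 := by simpa [P.young_Φ.map_zero] using (P.strictMono_Φ ha).ne'
  exact (ENNReal.lt_top_of_mul_ne_top_right (hle.trans_lt hi).ne hΦa).ne

end Orlicz

namespace OrliczSpace

variable {α : Type*} [MeasurableSpace α] {μ : Measure α} {P : YoungPair}

theorem mul_norm_le_two (f : OrliczSpace μ P) {a : ℝ≥0}
    (h : ∫⁻ x, P.Φ (a * ‖(f : α →ₘ[μ] ℂ) x‖₊) ∂μ ≤ 1) : a * ‖f‖ ≤ 2 := by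
  have ha : ‖((a : ℝ) : ℂ)‖₊ = a := by ext; simp
  have hle : eOrliczNorm P.Ψ (((a : ℝ) : ℂ) • (f : α →ₘ[μ] ℂ) : α → ℂ) μ ≤ 1 + 1 := by
    refine (eOrliczNorm_le_lintegral_Φ_add_one P
      ((AEEqFun.aestronglyMeasurable _).const_smul _)).trans (add_le_add_left ?_ 1)
    simpa only [Pi.smul_apply, nnnorm_smul, ha] using h
  rw [eOrliczNorm_const_smul, enorm_eq_nnnorm, ha, one_add_one_eq_two] at hle
  simpa [norm_def] using ENNReal.toReal_mono (by simp) hle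

theorem tendsto_of_lintegral_Φ {ι : Type*} {l : Filter ι} {f : ι → OrliczSpace μ P}
    {g : OrliczSpace μ P}
    (h : ∀ a : ℝ≥0, Tendsto
      (fun n => ∫⁻ x, P.Φ (a * ‖(f n : α →ₘ[μ] ℂ) x - (g : α →ₘ[μ] ℂ) x‖₊) ∂μ) l (𝓝 0)) :
    Tendsto f l (𝓝 g) := by
  rw [tendsto_iff_norm_sub_tendsto_zero]
  refine Metric.tendsto_nhds.2 fun ε hε => ?_
  lift ε to ℝ≥0 using hε.le
  have hε' : (0 : ℝ) < ε := hε
  filter_upwards [(h (3 / ε)).eventually (ge_mem_nhds zero_lt_one)] with n hn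
  have hle : (3 / ε : ℝ≥0) * ‖f n - g‖ ≤ 2 := by
    refine mul_norm_le_two _ ((lintegral_congr_ae ?_).trans_le hn)
    filter_upwards [AEEqFun.coeFn_sub (f n : α →ₘ[μ] ℂ) g] with x hx
    rw [Submodule.coe_sub, hx, Pi.sub_apply]
  push_cast at hle
  rw [div_mul_eq_mul_div, div_le_iff₀ hε'] at hle
  rw [dist_zero_right, norm_norm]
  linarith

theorem tendsto_of_bounded {f : ℕ → OrliczSpace μ P} {g : OrliczSpace μ P} {E : Set α}
    (hE : MeasurableSet E) (hμE : μ E ≠ ∞) {M : ℝ≥0}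
    (hM : ∀ n, ∀ᵐ x ∂μ, ‖(f n : α →ₘ[μ] ℂ) x - (g : α →ₘ[μ] ℂ) x‖₊ ≤ E.indicator (fun _ => M) x)
    (hlim : ∀ᵐ x ∂μ, Tendsto (fun n => (f n : α →ₘ[μ] ℂ) x) atTop (𝓝 ((g : α →ₘ[μ] ℂ) x))) :
    Tendsto f atTop (𝓝 g) := by
  refine tendsto_of_lintegral_Φ fun a => ?_
  rw [← lintegral_zero (μ := μ)]
  refine tendsto_lintegral_of_dominated_convergence' (E.indicator fun _ => P.Φ (a * M))
    (fun n => P.continuous_Φ.measurable.comp_aemeasurable (AEMeasurable.const_mul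
      ((AEEqFun.aestronglyMeasurable _).sub (AEEqFun.aestronglyMeasurable _)).nnnorm.aemeasurable
      a)) (fun n => ?_) ?_ ?_
  · filter_upwards [hM n] with x hx
    refine (P.strictMono_Φ.monotone (mul_le_mul_right hx a)).trans ?_
    by_cases h : x ∈ E <;> simp [h, P.young_Φ.map_zero]
  · rw [lintegral_indicator_const hE]
    exact ENNReal.mul_ne_top (P.Φ_ne_top _) hμE
  · filter_upwards [hlim] with x hx
    have hcont : Continuous fun z : ℂ => P.Φ (a * ‖z - (g : α →ₘ[μ] ℂ) x‖₊) :=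
      P.continuous_Φ.comp (by fun_prop)
    simpa [P.young_Φ.map_zero, Function.comp_def] using (hcont.tendsto _).comp hx

/-- The class in `L^Φ(μ)` of a function. -/
def ofFun {f : α → ℂ} (hf : MemOrlicz P.Φ f μ) : OrliczSpace μ P :=
  ⟨AEEqFun.mk f hf.1, hf.congr (AEEqFun.coeFn_mk f hf.1).symm⟩

theorem coe_ofFun {f : α → ℂ} (hf : MemOrlicz P.Φ f μ) : (ofFun hf : α →ₘ[μ] ℂ) =ᵐ[μ] f :=
  AEEqFun.coeFn_mk f hf.1

theorem ext_of_ae {f g : OrliczSpace μ P} (h : (f : α →ₘ[μ] ℂ) =ᵐ[μ] (g : α →ₘ[μ] ℂ)) : f = g :=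
  Subtype.ext (AEEqFun.ext h)

theorem mem_stepClosure_of_simpleFunc {E : Set α} (hE : MeasurableSet E) (hμE : μ E ≠ ∞)
    (s : SimpleFunc α ℂ) {g : OrliczSpace μ P} (hg : (g : α →ₘ[μ] ℂ) =ᵐ[μ] E.indicator s) :
    g ∈ StepClosure μ P := by
  have memOrlicz (t : SimpleFunc α ℂ) : MemOrlicz P.Φ (E.indicator t) μ := by
    obtain ⟨M, hM⟩ := t.exists_forall_norm_le
    have hM' (x : α) : ‖t x‖₊ ≤ M.toNNReal := NNReal.coe_le_coe.1 ((hM x).trans (le_max_left M 0))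
    refine memOrlicz_of_bounded P (t.aestronglyMeasurable.indicator hE) hE hμE
      (Eventually.of_forall fun x => ?_) (M := M.toNNReal)
    by_cases hx : x ∈ E <;> simp [hx, hM']
  induction s using SimpleFunc.induction generalizing g with
  | @const c A hA =>
    have h1 : MemOrlicz P.Φ ((A ∩ E).indicator fun _ => (1 : ℂ)) μ := by
      refine memOrlicz_of_bounded P (aestronglyMeasurable_const.indicator (hA.inter hE)) hE hμE
        (Eventually.of_forall fun x => ?_) (M := 1)
      by_cases hxA : x ∈ A <;> by_cases hxE : x ∈ E <;> simp [hxA, hxE]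
    have hgc : g = c • ofFun h1 := by
      refine ext_of_ae ?_
      filter_upwards [hg, AEEqFun.coeFn_smul c (ofFun h1 : α →ₘ[μ] ℂ), coe_ofFun h1]
        with x hx hc h1x
      rw [hx, Submodule.coe_smul, hc, Pi.smul_apply, h1x]
      by_cases hxA : x ∈ A <;> by_cases hxE : x ∈ E <;> simp [hxA, hxE]
    rw [hgc]
    exact Submodule.smul_mem _ c <| Submodule.le_topologicalClosure _ <|
      Submodule.subset_span ⟨A ∩ E, hA.inter hE, coe_ofFun h1⟩
  | @add s t _ hs ht =>
    have hgst : g = ofFun (memOrlicz s) + ofFun (memOrlicz t) := by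
      refine ext_of_ae ?_
      filter_upwards [hg, AEEqFun.coeFn_add (ofFun (memOrlicz s) : α →ₘ[μ] ℂ)
        (ofFun (memOrlicz t)), coe_ofFun (memOrlicz s), coe_ofFun (memOrlicz t)]
        with x hx ha hsx htx
      rw [hx, Submodule.coe_add, ha, Pi.add_apply, hsx, htx, SimpleFunc.coe_add,
        Set.indicator_add', Pi.add_apply]
    rw [hgst]
    exact Submodule.add_mem _ (hs (coe_ofFun _)) (ht (coe_ofFun _))

theorem mem_stepClosure_of_bounded (g : OrliczSpace μ P) {E : Set α} (hE : MeasurableSet E)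
    (hμE : μ E ≠ ∞) {M : ℝ≥0}
    (hM : ∀ᵐ x ∂μ, ‖(g : α →ₘ[μ] ℂ) x‖₊ ≤ E.indicator (fun _ => M) x) :
    g ∈ StepClosure μ P := by
  have hgm : StronglyMeasurable (g : α →ₘ[μ] ℂ) := AEEqFun.stronglyMeasurable _
  set s := hgm.approxBounded (M : ℝ)
  have hsM (n : ℕ) (x : α) : ‖E.indicator (s n) x‖₊ ≤ E.indicator (fun _ => M) x := by
    by_cases hx : x ∈ E
    · rw [Set.indicator_of_mem hx, Set.indicator_of_mem hx]
      exact hgm.norm_approxBounded_le M.2 n x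
    · simp [hx]
  have hs (n : ℕ) : MemOrlicz P.Φ (E.indicator (s n)) μ :=
    memOrlicz_of_bounded P ((s n).aestronglyMeasurable.indicator hE) hE hμE
      (Eventually.of_forall (hsM n))
  have hlim : Tendsto (fun n => ofFun (hs n)) atTop (𝓝 g) := by
    refine tendsto_of_bounded hE hμE (M := M + M) (fun n => ?_) ?_
    · filter_upwards [coe_ofFun (hs n), hM] with x hsx hx
      rw [hsx, Set.indicator_add]
      exact (nnnorm_sub_le _ _).trans (add_le_add (hsM n x) hx)
    · filter_upwards [ae_all_iff.2 fun n => coe_ofFun (hs n), hM] with x hsx hx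
      simp only [hsx]
      by_cases hxE : x ∈ E
      · simp only [Set.indicator_of_mem hxE] at hx ⊢
        exact hgm.tendsto_approxBounded_of_norm_le (by exact_mod_cast hx)
      · simp only [Set.indicator_of_notMem hxE] at hx ⊢
        rw [nnnorm_eq_zero.1 (le_antisymm hx zero_le)]
        exact tendsto_const_nhds
  exact (Submodule.isClosed_topologicalClosure _).mem_of_tendsto hlim <|
    Eventually.of_forall fun n => mem_stepClosure_of_simpleFunc hE hμE (s n) (coe_ofFun (hs n))

end OrliczSpace

section FinStronglyMeasurable

variable {α : Type*} [MeasurableSpace α] {μ : Measure α}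

theorem aefinStronglyMeasurable_of_eq_zero_imp {β γ : Type*} [TopologicalSpace β] [T2Space β]
    [Zero β] [TopologicalSpace γ] [Zero γ] {f : α → β} {g : α → γ}
    (hf : AEFinStronglyMeasurable f μ) (hg : AEStronglyMeasurable g μ)
    (h : ∀ᵐ x ∂μ, f x = 0 → g x = 0) : AEFinStronglyMeasurable g μ := by
  have hcompl := hf.ae_eq_zero_compl
  rw [EventuallyEq, ae_restrict_iff' hf.measurableSet.compl] at hcompl
  refine ⟨_, (hg.stronglyMeasurable_mk.indicator
    hf.measurableSet).finStronglyMeasurable_of_set_sigmaFinite hf.measurableSet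
    (fun x hx => Set.indicator_of_notMem hx _) hf.sigmaFinite_restrict, ?_⟩
  filter_upwards [hcompl, h, hg.ae_eq_mk] with x hx hfg hgx
  by_cases hxS : x ∈ hf.sigmaFiniteSet
  · rw [Set.indicator_of_mem hxS, hgx]
  · rw [Set.indicator_of_notMem hxS]
    exact hfg (hx hxS)

theorem MemOrlicz.aefinStronglyMeasurable {P : YoungPair} {f : α → ℂ} (hf : MemOrlicz P.Φ f μ) :
    AEFinStronglyMeasurable f μ := by
  obtain ⟨hm, a, ha, hi⟩ := hf
  have hq : AEMeasurable (fun x => P.Φ (a * ‖f x‖₊)) μ :=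
    P.continuous_Φ.measurable.comp_aemeasurable (hm.nnnorm.aemeasurable.const_mul a)
  refine aefinStronglyMeasurable_of_eq_zero_imp
    (integrable_toReal_of_lintegral_ne_top hq hi.ne).aefinStronglyMeasurable hm
    (Eventually.of_forall fun x hx => ?_)
  have hΦ : P.Φ (a * ‖f x‖₊) = P.Φ 0 := by
    rw [P.young_Φ.map_zero]
    exact ((ENNReal.toReal_eq_zero_iff _).1 hx).resolve_right (P.Φ_ne_top _)
  exact nnnorm_eq_zero.1 ((mul_eq_zero.1 (P.strictMono_Φ.injective hΦ)).resolve_left ha.ne')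

end FinStronglyMeasurable

namespace Weight

variable {G : Type*} [AddCommGroup G] [TopologicalSpace G] [MeasurableSpace G] {μ : Measure G}
  (ω : Weight μ)

theorem exists_inv_le : ∃ M : ℝ≥0, ∀ᵐ x ∂μ, (ω x)⁻¹ ≤ M := by
  have hfin := ω.inv_memLp_top.2
  rw [eLpNorm_exponent_top] at hfin
  refine ⟨(eLpNormEssSup (fun s => (ω s)⁻¹) μ).toNNReal, ?_⟩
  filter_upwards [ae_le_eLpNormEssSup (f := fun s => (ω s)⁻¹) (μ := μ)] with x hx
  simpa [abs_of_pos (ω.pos x), ENNReal.coe_toNNReal_eq_toReal] using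
    ENNReal.toReal_mono hfin.ne hx

theorem aestronglyMeasurable_ofReal : AEStronglyMeasurable (fun s => (ω s : ℂ)) μ :=
  (Complex.measurable_ofReal.comp_aemeasurable ω.aemeasurable).aestronglyMeasurable

theorem ofReal_ne_zero (s : G) : (ω s : ℂ) ≠ 0 := Complex.ofReal_ne_zero.2 (ω.pos s).ne'

theorem nnnorm_ofReal (s : G) : ‖(ω s : ℂ)‖₊ = (ω s).toNNReal := by
  ext
  simp [abs_of_pos (ω.pos s), (ω.pos s).le]

theorem nnnorm_mul_le_of_bounded {f : G → ℂ} {K : Set G} {M N : ℝ≥0}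
    (hN : ∀ x ∈ K, ω x ≤ N) (hf : ∀ᵐ x ∂μ, ‖f x‖₊ ≤ K.indicator (fun _ => M) x) :
    ∀ᵐ x ∂μ, ‖(ω x : ℂ) * f x‖₊ ≤ K.indicator (fun _ => N * M) x := by
  filter_upwards [hf] with x hx
  rw [nnnorm_mul, ω.nnnorm_ofReal]
  by_cases h : x ∈ K
  · rw [Set.indicator_of_mem h] at hx ⊢
    gcongr
    exact Real.toNNReal_le_iff_le_coe.2 (hN x h)
  · rw [Set.indicator_of_notMem h] at hx ⊢
    rw [le_antisymm hx zero_le, mul_zero]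

variable [IsTopologicalAddGroup G] [LocallyCompactSpace G] [T2Space G] [BorelSpace G]
  [μ.IsAddHaarMeasure] [μ.Regular]

theorem exists_measurableSet_bddAbove :
    ∃ E : Set G, MeasurableSet E ∧ μ E ≠ 0 ∧ μ E ≠ ∞ ∧
      ∃ n : ℕ, ∀ x ∈ E, ω x ≤ n ∧ ω (-x) ≤ n := by
  obtain ⟨W, hW, hW0⟩ := exists_compact_mem_nhds (0 : G)
  have hneg : AEMeasurable (fun x => ω (-x)) μ :=
    ω.aemeasurable.comp_quasiMeasurePreserving
      (Measure.measurePreserving_neg μ).quasiMeasurePreserving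
  set A : ℕ → Set G := fun n => W ∩ ({x | ω x ≤ n} ∩ {x | ω (-x) ≤ n})
  have hAm (n : ℕ) : NullMeasurableSet (A n) μ :=
    hW.measurableSet.nullMeasurableSet.inter
      ((nullMeasurableSet_le ω.aemeasurable aemeasurable_const).inter
        (nullMeasurableSet_le hneg aemeasurable_const))
  obtain ⟨n, hn⟩ : ∃ n, μ (A n) ≠ 0 := by
    by_contra! hnull
    have hWA : W ⊆ ⋃ n, A n := fun x hx => by
      obtain ⟨n, hn⟩ := exists_nat_ge (max (ω x) (ω (-x)))
      exact Set.mem_iUnion.2 ⟨n, hx, (le_max_left _ _).trans hn, (le_max_right _ _).trans hn⟩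
    exact (Measure.measure_pos_of_mem_nhds μ hW0).ne'
      (measure_mono_null hWA (measure_iUnion_null hnull))
  obtain ⟨E, hEA, hE, hEae⟩ := (hAm n).exists_measurable_subset_ae_eq
  refine ⟨E, hE, (measure_congr hEae).trans_ne hn, ?_, n, fun x hx => (hEA hx).2⟩
  exact ((measure_mono (hEA.trans Set.inter_subset_left)).trans_lt hW.measure_lt_top).ne

-- Steinhaus: `E - E` is a neighbourhood of `0` if `E` has positive measure.
theorem exists_mem_nhds_zero_bddAbove : ∃ V ∈ 𝓝 (0 : G), BddAbove (ω '' V) := by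
  obtain ⟨C, hC, hsub⟩ := ω.submul
  obtain ⟨E, hE, hE0, hEtop, n, hn⟩ := ω.exists_measurableSet_bddAbove
  refine ⟨E - E, Measure.sub_mem_nhds_zero_of_addHaar_pos_ne_top μ E hE (pos_iff_ne_zero.2 hE0)
    hEtop, C * (n * n), ?_⟩
  rintro _ ⟨_, ⟨s, hs, t, ht, rfl⟩, rfl⟩
  calc ω (s - t) = ω (s + -t) := by rw [sub_eq_add_neg]
    _ ≤ C * (ω s * ω (-t)) := hsub s (-t)
    _ ≤ C * (n * n) := by
        have := (ω.pos (-t)).le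
        gcongr
        exacts [(hn s hs).1, (hn t ht).2]

theorem exists_le_of_isCompact {K : Set G} (hK : IsCompact K) :
    ∃ M : ℝ≥0, ∀ x ∈ K, ω x ≤ M := by
  obtain ⟨C, hC, hsub⟩ := ω.submul
  obtain ⟨V, hV, B, hB⟩ := ω.exists_mem_nhds_zero_bddAbove
  suffices BddAbove (ω '' K) by
    obtain ⟨M, hM⟩ := this
    exact ⟨M.toNNReal, fun x hx => (hM ⟨x, hx, rfl⟩).trans (Real.le_coe_toNNReal M)⟩
  refine hK.induction_on (p := fun S => BddAbove (ω '' S)) (by simp)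
    (fun S T hST hT => hT.mono (Set.image_mono hST))
    (fun S T hS hT => by rw [Set.image_union]; exact hS.union hT) fun x _ => ?_
  refine ⟨(fun y => y - x) ⁻¹' V, mem_nhdsWithin_of_mem_nhds
    ((continuous_sub_right x).continuousAt.preimage_mem_nhds (by rwa [sub_self])),
    C * (ω x * B), ?_⟩
  rintro _ ⟨y, hy, rfl⟩
  calc ω y = ω (x + (y - x)) := by rw [add_sub_cancel]
    _ ≤ C * (ω x * ω (y - x)) := hsub x (y - x)
    _ ≤ C * (ω x * B) := by
        have := (ω.pos x).le
        gcongr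
        exact hB ⟨_, hy, rfl⟩

end Weight

namespace WeightedOrliczSpace

variable {G : Type*} [AddCommGroup G] [TopologicalSpace G] [MeasurableSpace G] {μ : Measure G}
  {P : YoungPair} {ω : Weight μ}

theorem ext_of_ae {f g : WeightedOrliczSpace P ω}
    (h : (f : G →ₘ[μ] ℂ) =ᵐ[μ] (g : G →ₘ[μ] ℂ)) : f = g :=
  Subtype.ext (AEEqFun.ext h)

theorem coe_mulWeight (f : WeightedOrliczSpace P ω) :
    (mulWeight P ω f : G →ₘ[μ] ℂ) =ᵐ[μ] fun s => (ω s : ℂ) * (f : G →ₘ[μ] ℂ) s :=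
  ω.coeFn_mul f

theorem isometry_mulWeight : Isometry (mulWeight P ω) :=
  AddMonoidHomClass.isometry_of_norm _ fun _ => rfl

theorem memOrlicz (f : WeightedOrliczSpace P ω) :
    MemOrlicz P.Φ (fun s => (ω s : ℂ) * (f : G →ₘ[μ] ℂ) s) μ :=
  MemOrlicz.congr (coe_mulWeight f) (mulWeight P ω f).2

theorem lintegral_Φ_le_one {f : WeightedOrliczSpace P ω} (hf : ‖f‖ ≤ 1) :
    ∫⁻ s, P.Φ ‖(ω s : ℂ) * (f : G →ₘ[μ] ℂ) s‖₊ ∂μ ≤ 1 := by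
  refine MemOrlicz.lintegral_Φ_le_one P (memOrlicz f) ?_
  rw [← eOrliczNorm_congr (coe_mulWeight f)]
  exact (ENNReal.toReal_le_toReal (MemOrlicz.eOrliczNorm_lt_top P (mulWeight P ω f).2).ne
    ENNReal.one_ne_top).1 (by rw [ENNReal.toReal_one]; exact hf)

/-- The class in `L^Φ_ω(G)` of a function. -/
def ofFun {f : G → ℂ} (hf : AEStronglyMeasurable f μ)
    (h : MemOrlicz P.Φ (fun s => (ω s : ℂ) * f s) μ) : WeightedOrliczSpace P ω :=
  ⟨AEEqFun.mk f hf, by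
    refine MemOrlicz.congr ?_ h
    filter_upwards [ω.coeFn_mul (AEEqFun.mk f hf), AEEqFun.coeFn_mk f hf] with s hω hs
    exact (hω.trans (by rw [hs])).symm⟩

theorem coe_ofFun {f : G → ℂ} (hf : AEStronglyMeasurable f μ)
    (h : MemOrlicz P.Φ (fun s => (ω s : ℂ) * f s) μ) :
    (ofFun (P := P) (ω := ω) hf h : G →ₘ[μ] ℂ) =ᵐ[μ] f :=
  AEEqFun.coeFn_mk f hf

theorem aefinStronglyMeasurable (f : WeightedOrliczSpace P ω) :
    AEFinStronglyMeasurable (f : G →ₘ[μ] ℂ) μ :=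
  aefinStronglyMeasurable_of_eq_zero_imp (memOrlicz f).aefinStronglyMeasurable
    (AEEqFun.aestronglyMeasurable _)
    (Eventually.of_forall fun s hs => (mul_eq_zero.1 hs).resolve_left (ω.ofReal_ne_zero s))

theorem aefinStronglyMeasurable_mul (f : WeightedOrliczSpace P ω) {g : G → ℂ}
    (hg : AEStronglyMeasurable g μ) :
    AEFinStronglyMeasurable (fun s => (f : G →ₘ[μ] ℂ) s * g s) μ :=
  aefinStronglyMeasurable_of_eq_zero_imp (aefinStronglyMeasurable f)
    ((AEEqFun.aestronglyMeasurable _).mul hg)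
    (Eventually.of_forall fun _ hs => mul_eq_zero_of_left hs _)

theorem exists_coe_ae_eq_norm (f : WeightedOrliczSpace P ω) :
    ∃ g : WeightedOrliczSpace P ω,
      (g : G →ₘ[μ] ℂ) =ᵐ[μ] fun s => ((‖(f : G →ₘ[μ] ℂ) s‖ : ℝ) : ℂ) := by
  have hm : AEStronglyMeasurable (fun s => ((‖(f : G →ₘ[μ] ℂ) s‖ : ℝ) : ℂ)) μ :=
    Complex.continuous_ofReal.comp_aestronglyMeasurable (AEEqFun.aestronglyMeasurable _).norm
  obtain ⟨-, a, ha, hi⟩ := memOrlicz f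
  refine ⟨ofFun hm ⟨ω.aestronglyMeasurable_ofReal.mul hm, a, ha, ?_⟩, coe_ofFun hm _⟩
  simpa only [nnnorm_mul, Complex.nnnorm_real, nnnorm_norm] using hi

theorem locallyIntegrable [LocallyCompactSpace G] [IsFiniteMeasureOnCompacts μ]
    (f : WeightedOrliczSpace P ω) : LocallyIntegrable (f : G →ₘ[μ] ℂ) μ := by
  refine locallyIntegrable_iff.2 fun K hK => ⟨(AEEqFun.aestronglyMeasurable _).restrict, ?_⟩
  obtain ⟨M, hM⟩ := ω.exists_inv_le
  obtain ⟨hm, a, ha, hi⟩ := memOrlicz f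
  have hmeas : AEMeasurable
      (fun s => P.Φ (a * ‖(ω s : ℂ) * (f : G →ₘ[μ] ℂ) s‖₊)) (μ.restrict K) :=
    (P.continuous_Φ.measurable.comp_aemeasurable (hm.nnnorm.aemeasurable.const_mul a)).restrict
  have hle : ∀ᵐ s ∂μ, ‖(f : G →ₘ[μ] ℂ) s‖ₑ ≤
      (M / a : ℝ≥0) * (P.Φ (a * ‖(ω s : ℂ) * (f : G →ₘ[μ] ℂ) s‖₊) + P.Ψ 1) := by
    filter_upwards [hM] with s hs
    refine le_trans ?_ (mul_le_mul_right (P.young _ 1) _)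
    rw [enorm_eq_nnnorm, ← ENNReal.coe_mul, ENNReal.coe_le_coe, nnnorm_mul, ω.nnnorm_ofReal,
      mul_one, ← mul_assoc, ← mul_assoc, div_mul_cancel₀ _ ha.ne']
    refine le_mul_of_one_le_left zero_le ?_
    rw [inv_le_iff_one_le_mul₀ (ω.pos s)] at hs
    rw [← NNReal.coe_le_coe]
    simpa [(ω.pos s).le] using hs
  calc ∫⁻ s in K, ‖(f : G →ₘ[μ] ℂ) s‖ₑ ∂μ
      ≤ ∫⁻ s in K, (M / a : ℝ≥0) *
          (P.Φ (a * ‖(ω s : ℂ) * (f : G →ₘ[μ] ℂ) s‖₊) + P.Ψ 1) ∂μ :=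
        lintegral_mono_ae (ae_restrict_of_ae hle)
    _ = (M / a : ℝ≥0) * (∫⁻ s in K, P.Φ (a * ‖(ω s : ℂ) * (f : G →ₘ[μ] ℂ) s‖₊) ∂μ
          + P.Ψ 1 * μ K) := by
        rw [lintegral_const_mul' _ _ ENNReal.coe_ne_top, lintegral_add_left' hmeas,
          setLIntegral_const]
    _ < ∞ := ENNReal.mul_lt_top ENNReal.coe_lt_top <| ENNReal.add_lt_top.2
        ⟨(setLIntegral_le_lintegral _ _).trans_lt hi,
          ENNReal.mul_lt_top (P.Ψ_ne_top 1).lt_top hK.measure_lt_top⟩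

end WeightedOrliczSpace

section BoundedCompact

variable {G : Type*} [AddCommGroup G] [TopologicalSpace G] [MeasurableSpace G] {μ : Measure G}

/-- The bounded functions of compact support in `L^Φ_ω(G)`. They are dense in `S^Φ_ω(G)`, and their
products under convolution are of the same kind. -/
def BoundedCompact (P : YoungPair) (ω : Weight μ) : Submodule ℂ (WeightedOrliczSpace P ω) where
  carrier := {f | ∃ (K : Set G) (M : ℝ≥0), IsCompact K ∧
    ∀ᵐ x ∂μ, ‖(f : G →ₘ[μ] ℂ) x‖₊ ≤ K.indicator (fun _ => M) x}
  add_mem' := by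
    rintro f g ⟨K, M, hK, hf⟩ ⟨L, N, hL, hg⟩
    refine ⟨K ∪ L, M + N, hK.union hL, ?_⟩
    filter_upwards [hf, hg, AEEqFun.coeFn_add (f : G →ₘ[μ] ℂ) g] with x hfx hgx hx
    rw [Submodule.coe_add, hx, Pi.add_apply]
    refine (nnnorm_add_le _ _).trans ((add_le_add hfx hgx).trans ?_)
    by_cases hxK : x ∈ K <;> by_cases hxL : x ∈ L <;> simp [hxK, hxL]
  zero_mem' := by
    refine ⟨∅, 0, isCompact_empty, ?_⟩
    filter_upwards [AEEqFun.coeFn_zero (α := G) (β := ℂ) (μ := μ)] with x hx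
    simp [hx]
  smul_mem' := by
    rintro c f ⟨K, M, hK, hf⟩
    refine ⟨K, ‖c‖₊ * M, hK, ?_⟩
    filter_upwards [hf, AEEqFun.coeFn_smul c (f : G →ₘ[μ] ℂ)] with x hfx hx
    rw [Submodule.coe_smul, hx, Pi.smul_apply, nnnorm_smul]
    refine (mul_le_mul_right hfx _).trans ?_
    by_cases hxK : x ∈ K <;> simp [hxK]

variable {P : YoungPair} {ω : Weight μ}

theorem isClosed_weightedStepClosure :
    IsClosed (WeightedStepClosure P ω : Set (WeightedOrliczSpace P ω)) :=
  (Submodule.isClosed_topologicalClosure _).preimage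
    WeightedOrliczSpace.isometry_mulWeight.continuous

variable [IsTopologicalAddGroup G] [LocallyCompactSpace G] [BorelSpace G]

theorem nnnorm_convolution_le_indicator [μ.IsAddHaarMeasure] [μ.Regular] {f g : G → ℂ}
    {K L : Set G} {M N : ℝ≥0} (hf : ∀ᵐ x ∂μ, ‖f x‖₊ ≤ K.indicator (fun _ => M) x)
    (hg : ∀ᵐ x ∂μ, ‖g x‖₊ ≤ L.indicator (fun _ => N) x) (hK : μ K ≠ ∞) (x : G) :
    ‖∫ t, f t * g (x - t) ∂μ‖₊ ≤ (K + L).indicator (fun _ => M * N * (μ K).toNNReal) x := by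
  set A : Set G := K ∩ (fun t => x - t) ⁻¹' L with hA
  have hle : ∀ᵐ t ∂μ, ‖f t * g (x - t)‖ₑ ≤ A.indicator (fun _ => ((M * N : ℝ≥0) : ℝ≥0∞)) t := by
    filter_upwards [hf, (Measure.measurePreserving_sub_left μ x).quasiMeasurePreserving.ae hg]
      with t hft hgt
    rw [enorm_eq_nnnorm, nnnorm_mul]
    refine (ENNReal.coe_le_coe.2 (mul_le_mul' hft hgt)).trans ?_
    by_cases htK : t ∈ K <;> by_cases htL : x - t ∈ L <;> simp [htK, htL, hA]
  have hint : ‖∫ t, f t * g (x - t) ∂μ‖ₑ ≤ (M * N : ℝ≥0) * μ A :=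
    (enorm_integral_le_lintegral_enorm _).trans
      ((lintegral_mono_ae hle).trans (lintegral_indicator_const_le _ _))
  rw [← ENNReal.coe_le_coe, ← enorm_eq_nnnorm]
  by_cases hx : x ∈ K + L
  · rw [Set.indicator_of_mem hx, ENNReal.coe_mul, ENNReal.coe_toNNReal hK]
    exact hint.trans (mul_le_mul_right (measure_mono Set.inter_subset_left) _)
  · have hA0 : A = ∅ := Set.eq_empty_of_forall_notMem fun t ht =>
      hx ⟨t, ht.1, x - t, ht.2, add_sub_cancel t x⟩
    simpa [hA0, hx] using hint

variable [T2Space G] [μ.IsAddHaarMeasure] [μ.Regular]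

theorem boundedCompact_le_weightedStepClosure : BoundedCompact P ω ≤ WeightedStepClosure P ω := by
  rintro f ⟨K, M, hK, hf⟩
  obtain ⟨N, hN⟩ := ω.exists_le_of_isCompact hK
  refine OrliczSpace.mem_stepClosure_of_bounded _ hK.measurableSet hK.measure_lt_top.ne
    (M := N * M) ?_
  filter_upwards [WeightedOrliczSpace.coe_mulWeight f, ω.nnnorm_mul_le_of_bounded hN hf]
    with x hx hωf
  rwa [hx]

theorem exists_mem_boundedCompact_coe_ae_eq {f : G → ℂ} (hf : AEStronglyMeasurable f μ) {K : Set G}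
    (hK : IsCompact K) {M : ℝ≥0} (hM : ∀ᵐ x ∂μ, ‖f x‖₊ ≤ K.indicator (fun _ => M) x) :
    ∃ g ∈ BoundedCompact P ω, (g : G →ₘ[μ] ℂ) =ᵐ[μ] f := by
  obtain ⟨N, hN⟩ := ω.exists_le_of_isCompact hK
  have hmem : MemOrlicz P.Φ (fun s => (ω s : ℂ) * f s) μ :=
    memOrlicz_of_bounded P (ω.aestronglyMeasurable_ofReal.mul hf) hK.measurableSet
      hK.measure_lt_top.ne (ω.nnnorm_mul_le_of_bounded hN hM)
  refine ⟨WeightedOrliczSpace.ofFun hf hmem, ⟨K, M, hK, ?_⟩, WeightedOrliczSpace.coe_ofFun hf hmem⟩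
  filter_upwards [hM, WeightedOrliczSpace.coe_ofFun hf hmem] with x hMx hx
  rwa [hx]

theorem exists_mem_boundedCompact_mulWeight_ae_eq {K : Set G} (hK : IsCompact K) :
    ∃ g ∈ BoundedCompact P ω,
      (WeightedOrliczSpace.mulWeight P ω g : G →ₘ[μ] ℂ) =ᵐ[μ] K.indicator fun _ => (1 : ℂ) := by
  obtain ⟨M, hM⟩ := ω.exists_inv_le
  have hbound : ∀ᵐ x ∂μ, ‖K.indicator (fun x => (ω x : ℂ)⁻¹) x‖₊ ≤ K.indicator (fun _ => M) x := by
    filter_upwards [hM] with x hx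
    by_cases hxK : x ∈ K
    · rw [Set.indicator_of_mem hxK, Set.indicator_of_mem hxK, ← NNReal.coe_le_coe]
      simpa [abs_of_pos (ω.pos x)] using hx
    · simp [hxK]
  obtain ⟨g, hg, hgK⟩ := exists_mem_boundedCompact_coe_ae_eq (P := P) (ω := ω)
    ((Complex.measurable_ofReal.comp_aemeasurable
      ω.aemeasurable).inv.aestronglyMeasurable.indicator hK.measurableSet) hK hbound
  refine ⟨g, hg, ?_⟩
  filter_upwards [WeightedOrliczSpace.coe_mulWeight g, hgK] with x hx hgx
  rw [hx, hgx]
  by_cases hxK : x ∈ K <;> simp [hxK, ω.ofReal_ne_zero x]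

theorem indicator_mem_closure_map_boundedCompact {g : OrliczSpace μ P} {E : Set G}
    (hE : MeasurableSet E) (hg : (g : G →ₘ[μ] ℂ) =ᵐ[μ] E.indicator fun _ => (1 : ℂ)) :
    g ∈ ((BoundedCompact P ω).map (WeightedOrliczSpace.mulWeight P ω)).topologicalClosure := by
  have hμE : μ E ≠ ∞ := MemOrlicz.measure_ne_top P hE (MemOrlicz.congr hg g.2)
  choose K hKE hK hlt using fun n : ℕ => hE.exists_isCompact_sdiff_lt (μ := μ) hμE
    (ENNReal.inv_ne_zero.2 (ENNReal.natCast_ne_top n))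
  have hsmall : Tendsto (fun n => μ (E \ K n)) atTop (𝓝 0) :=
    tendsto_of_tendsto_of_tendsto_of_le_of_le tendsto_const_nhds
      ENNReal.tendsto_inv_nat_nhds_zero (fun _ => zero_le) fun n => (hlt n).le
  choose h hh hhK using fun n =>
    exists_mem_boundedCompact_mulWeight_ae_eq (P := P) (ω := ω) (hK n)
  have hlim : Tendsto (fun n => WeightedOrliczSpace.mulWeight P ω (h n)) atTop (𝓝 g) := by
    refine OrliczSpace.tendsto_of_lintegral_Φ fun a => ?_
    have hmod (n : ℕ) : ∫⁻ x, P.Φ (a * ‖(WeightedOrliczSpace.mulWeight P ω (h n) : G →ₘ[μ] ℂ) x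
        - (g : G →ₘ[μ] ℂ) x‖₊) ∂μ = P.Φ a * μ (E \ K n) := by
      rw [← lintegral_indicator_const (hE.diff (hK n).measurableSet)]
      refine lintegral_congr_ae ?_
      filter_upwards [hhK n, hg] with x hx hgx
      rw [hx, hgx]
      by_cases hxK : x ∈ K n
      · simp [hxK, hKE n hxK, P.young_Φ.map_zero]
      · by_cases hxE : x ∈ E <;> simp [hxK, hxE, P.young_Φ.map_zero]
    simp only [hmod]
    simpa using ENNReal.Tendsto.const_mul hsmall (.inr (P.Φ_ne_top a))
  exact (Submodule.isClosed_topologicalClosure _).mem_of_tendsto hlim (Eventually.of_forall fun n =>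
    Submodule.le_topologicalClosure _ (Submodule.mem_map_of_mem (hh n)))

theorem weightedStepClosure_le_closure_boundedCompact :
    WeightedStepClosure P ω ≤ (BoundedCompact P ω).topologicalClosure := by
  intro f hf
  have hle : StepClosure μ P
      ≤ ((BoundedCompact P ω).map (WeightedOrliczSpace.mulWeight P ω)).topologicalClosure :=
    Submodule.topologicalClosure_minimal _
      (Submodule.span_le.2 fun _ ⟨_, hE, hg⟩ => indicator_mem_closure_map_boundedCompact hE hg)
      (Submodule.isClosed_topologicalClosure _)
  have hfω := hle hf
  rw [← SetLike.mem_coe, Submodule.topologicalClosure_coe, Submodule.map_coe] at hfω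
  rw [← SetLike.mem_coe, Submodule.topologicalClosure_coe,
    WeightedOrliczSpace.isometry_mulWeight.isEmbedding.isInducing.closure_eq_preimage_closure_image]
  exact hfω

end BoundedCompact

namespace IsConvolutionProduct

variable {G : Type*} [AddCommGroup G] [TopologicalSpace G] [MeasurableSpace G] {μ : Measure G}
  {P : YoungPair} {ω : Weight μ}
  {m : WeightedOrliczSpace P ω →L[ℂ] WeightedOrliczSpace P ω →L[ℂ] WeightedOrliczSpace P ω}

theorem coe_eq (hm : IsConvolutionProduct P ω m) (f g : WeightedOrliczSpace P ω) :
    (m f g : G →ₘ[μ] ℂ) =ᵐ[μ]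
      fun x => ∫ t, (f : G →ₘ[μ] ℂ) t * (g : G →ₘ[μ] ℂ) (x - t) ∂μ :=
  (hm f g).2

variable [IsTopologicalAddGroup G] [LocallyCompactSpace G] [BorelSpace G]
  [μ.IsAddHaarMeasure] [μ.Regular]

theorem comm (hm : IsConvolutionProduct P ω m) (f g : WeightedOrliczSpace P ω) :
    m f g = m g f := by
  refine WeightedOrliczSpace.ext_of_ae ?_
  filter_upwards [hm.coe_eq f g, hm.coe_eq g f] with x hfg hgf
  rw [hfg, hgf, ← integral_sub_left_eq_self _ μ x]
  simp only [sub_sub_cancel, mul_comm]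

theorem mul_mem_boundedCompact (hm : IsConvolutionProduct P ω m) {f g : WeightedOrliczSpace P ω}
    (hf : f ∈ BoundedCompact P ω) (hg : g ∈ BoundedCompact P ω) : m f g ∈ BoundedCompact P ω := by
  obtain ⟨K, M, hK, hf⟩ := hf
  obtain ⟨L, N, hL, hg⟩ := hg
  refine ⟨K + L, M * N * (μ K).toNNReal, hK.add hL, ?_⟩
  filter_upwards [hm.coe_eq f g] with x hx
  rw [hx]
  exact nnnorm_convolution_le_indicator hf hg hK.measure_lt_top.ne x

variable [T2Space G]

theorem mul_mem_weightedStepClosure (hm : IsConvolutionProduct P ω m)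
    {f g : WeightedOrliczSpace P ω} (hf : f ∈ WeightedStepClosure P ω)
    (hg : g ∈ WeightedStepClosure P ω) : m f g ∈ WeightedStepClosure P ω := by
  have hmem : m f g ∈ closure (BoundedCompact P ω : Set (WeightedOrliczSpace P ω)) :=
    map_mem_closure₂ (f := fun f g => m f g) m.continuous₂
      (weightedStepClosure_le_closure_boundedCompact hf)
      (weightedStepClosure_le_closure_boundedCompact hg)
      fun _ hf _ hg => hm.mul_mem_boundedCompact hf hg
  exact closure_minimal boundedCompact_le_weightedStepClosure isClosed_weightedStepClosure hmem

/-- The convolution product of `S^Φ_ω(G)`. -/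
def restrict (hm : IsConvolutionProduct P ω m) :
    WeightedStepClosure P ω →L[ℂ] WeightedStepClosure P ω →L[ℂ] WeightedStepClosure P ω :=
  LinearMap.mkContinuous₂
    (LinearMap.mk₂ ℂ (fun f g : WeightedStepClosure P ω =>
        (⟨m f g, hm.mul_mem_weightedStepClosure f.2 g.2⟩ : WeightedStepClosure P ω))
      (fun _ _ _ => Subtype.ext (by simp)) (fun _ _ _ => Subtype.ext (by simp))
      (fun _ _ _ => Subtype.ext (by simp)) (fun _ _ _ => Subtype.ext (by simp)))
    ‖m‖ fun f g => m.le_opNorm₂ f g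

end IsConvolutionProduct

section ModularDomination

variable {α : Type*} [MeasurableSpace α] {μ : Measure α} {P : YoungPair} {η : α → ℂ}

/-- Up to a constant, `|η(s)| x y` is dominated by the values `Φ x` and `Φ y`, their product and
`h(s)` for some integrable `h`. -/
def IsModularDominated (P : YoungPair) (η : α → ℂ) (μ : Measure α) : Prop :=
  ∃ (R : ℝ≥0) (h : α → ℝ≥0∞), AEMeasurable h μ ∧ ∫⁻ s, h s ∂μ ≠ ∞ ∧
    ∀ᵐ s ∂μ, ∀ x y : ℝ≥0, ((‖η s‖₊ * x * y : ℝ≥0) : ℝ≥0∞)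
      ≤ R * (P.Φ x * P.Φ y + (P.Φ x + h s) + P.Φ y)

theorem mul_le_min_sq_mul_min_sq_add (x y : ℝ≥0) :
    x * y ≤ min x (x ^ 2) * min y (y ^ 2) + min x (x ^ 2) + min y (y ^ 2) := by
  have hle (z : ℝ≥0) (hz : z ≤ 1) : min z (z ^ 2) = z ^ 2 :=
    min_eq_right (pow_le_of_le_one zero_le hz two_ne_zero)
  have hge (z : ℝ≥0) (hz : 1 ≤ z) : min z (z ^ 2) = z := min_eq_left (le_self_pow₀ hz two_ne_zero)
  rcases le_total x 1 with hx | hx <;> rcases le_total y 1 with hy | hy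
  · rw [hle x hx, hle y hy, ← NNReal.coe_le_coe]
    push_cast
    nlinarith [sq_nonneg ((x : ℝ) - y), sq_nonneg ((x : ℝ) * y), sq_nonneg (x : ℝ),
      sq_nonneg (y : ℝ)]
  · rw [hge y hy]
    exact (mul_le_of_le_one_left zero_le hx).trans le_add_self
  · rw [hge x hx]
    exact (mul_le_of_le_one_right zero_le hy).trans (le_add_self.trans le_self_add)
  · rw [hge x hx, hge y hy]
    exact le_self_add.trans le_self_add

theorem isModularDominated_of_memLp_top (hη : MemLp η ∞ μ) {c : ℝ≥0}
    (hc : ∀ y ≤ 1, P.Ψ y ≤ c * (y : ℝ≥0∞) ^ 2) : IsModularDominated P η μ := by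
  obtain ⟨C, hC⟩ := P.exists_min_sq_le_mul_Φ hc
  have hfin : eLpNormEssSup η μ ≠ ∞ := by
    rw [← eLpNorm_exponent_top]
    exact hη.2.ne
  lift eLpNormEssSup η μ to ℝ≥0 using hfin with M hM
  refine ⟨M * (C * C + C), fun _ => 0, aemeasurable_const, by simp, ?_⟩
  filter_upwards [ae_le_eLpNormEssSup (f := η) (μ := μ)] with s hs x y
  rw [← hM, enorm_eq_nnnorm, ENNReal.coe_le_coe] at hs
  set u := min x (x ^ 2)
  set v := min y (y ^ 2)
  calc ((‖η s‖₊ * x * y : ℝ≥0) : ℝ≥0∞)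
      ≤ ((M * (u * v + u + v) : ℝ≥0) : ℝ≥0∞) := by
        rw [mul_assoc]
        exact ENNReal.coe_le_coe.2 (mul_le_mul' hs (mul_le_min_sq_mul_min_sq_add x y))
    _ = M * (u * v + u + v) := by push_cast; rfl
    _ ≤ M * ((C * P.Φ x) * (C * P.Φ y) + C * P.Φ x + C * P.Φ y) := by
        gcongr <;> exact hC _
    _ ≤ M * ((C * C + C) * (P.Φ x * P.Φ y) + (C * C + C) * P.Φ x + (C * C + C) * P.Φ y) := by
        rw [mul_mul_mul_comm]
        gcongr
        exacts [le_self_add, le_add_self, le_add_self]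
    _ = (M * (C * C + C) : ℝ≥0) * (P.Φ x * P.Φ y + (P.Φ x + 0) + P.Φ y) := by push_cast; ring

theorem complementary_mono (Φ : ℝ≥0 → ℝ≥0∞) : Monotone (complementary Φ) := fun _ _ hyz =>
  iSup_mono fun x => tsub_le_tsub_right (ENNReal.coe_le_coe.2 (mul_le_mul_right hyz x)) _

theorem YoungPair.Φ_sqrt_mul_le_add (P : YoungPair) (x y : ℝ≥0) :
    P.Φ (NNReal.sqrt (x * y)) ≤ P.Φ x + P.Φ y := by
  have hsqrt : NNReal.sqrt (x * y) ≤ max x y := by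
    rw [NNReal.sqrt_le_iff_le_sq, sq]
    exact mul_le_mul' (le_max_left _ _) (le_max_right _ _)
  refine (P.strictMono_Φ.monotone hsqrt).trans ?_
  rw [P.strictMono_Φ.monotone.map_max]
  exact max_le_add_of_nonneg zero_le zero_le

theorem isModularDominated_of_memOrlicz
    (hη : MemOrlicz (complementary fun x => P.Φ (NNReal.sqrt x)) η μ) :
    IsModularDominated P η μ := by
  obtain ⟨hm, a, ha, hi⟩ := hη
  refine ⟨a⁻¹, fun s => complementary (fun x => P.Φ (NNReal.sqrt x)) (a * ‖η s‖₊),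
    (complementary_mono _).measurable.comp_aemeasurable (hm.nnnorm.aemeasurable.const_mul a), hi.ne,
    Eventually.of_forall fun s x y => ?_⟩
  set k := complementary (fun x => P.Φ (NNReal.sqrt x)) (a * ‖η s‖₊)
  have hyoung : ((x * y * (a * ‖η s‖₊) : ℝ≥0) : ℝ≥0∞) ≤ P.Φ x + P.Φ y + k :=
    (young_inequality _ _ _).trans (by gcongr; exact P.Φ_sqrt_mul_le_add x y)
  calc ((‖η s‖₊ * x * y : ℝ≥0) : ℝ≥0∞)
      = (a⁻¹ : ℝ≥0) * ((x * y * (a * ‖η s‖₊) : ℝ≥0) : ℝ≥0∞) := by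
        rw [← ENNReal.coe_mul]
        congr 1
        field_simp
    _ ≤ (a⁻¹ : ℝ≥0) * (P.Φ x * P.Φ y + (P.Φ x + k) + P.Φ y) := by
        gcongr (a⁻¹ : ℝ≥0) * ?_
        refine hyoung.trans ?_
        rw [add_right_comm, add_assoc (P.Φ x * P.Φ y)]
        exact le_add_self

end ModularDomination

section AbsForm

theorem exists_norm_le_one_eq_norm_smul {E : Type*} [NormedAddCommGroup E] [NormedSpace ℂ E]
    (v : E) : ∃ w : E, ‖w‖ ≤ 1 ∧ v = (‖v‖ : ℂ) • w := by
  rcases eq_or_ne v 0 with rfl | hv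
  · exact ⟨0, by simp, by simp⟩
  · have hne : (‖v‖ : ℂ) ≠ 0 := Complex.ofReal_ne_zero.2 (norm_ne_zero_iff.2 hv)
    exact ⟨(‖v‖ : ℂ)⁻¹ • v, by simp [norm_smul, norm_ne_zero_iff.2 hv], by rw [smul_inv_smul₀ hne]⟩

theorem le_mul_enorm_mul_enorm_of_homogeneous {E F : Type*} [NormedAddCommGroup E]
    [NormedSpace ℂ E] [NormedAddCommGroup F] [NormedSpace ℂ F] {B : E → F → ℝ≥0∞} {C : ℝ≥0∞}
    (hB : ∀ (a b : ℂ) (x : E) (y : F), B (a • x) (b • y) = ‖a‖ₑ * ‖b‖ₑ * B x y)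
    (hC : ∀ x y, ‖x‖ ≤ 1 → ‖y‖ ≤ 1 → B x y ≤ C) (x : E) (y : F) : B x y ≤ C * ‖x‖ₑ * ‖y‖ₑ := by
  obtain ⟨x₁, hx₁, hx⟩ := exists_norm_le_one_eq_norm_smul x
  obtain ⟨y₁, hy₁, hy⟩ := exists_norm_le_one_eq_norm_smul y
  have hnorm (r : ℝ) (hr : 0 ≤ r) : ‖(r : ℂ)‖ₑ = ENNReal.ofReal r := by
    rw [← ofReal_norm, Complex.norm_of_nonneg hr]
  calc B x y = B ((‖x‖ : ℂ) • x₁) ((‖y‖ : ℂ) • y₁) := by rw [← hx, ← hy]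
    _ = ‖x‖ₑ * ‖y‖ₑ * B x₁ y₁ := by
        rw [hB, hnorm _ (norm_nonneg x), hnorm _ (norm_nonneg y), ofReal_norm, ofReal_norm]
    _ ≤ ‖x‖ₑ * ‖y‖ₑ * C := by gcongr; exact hC x₁ y₁ hx₁ hy₁
    _ = C * ‖x‖ₑ * ‖y‖ₑ := by ring

variable {G : Type*} [AddCommGroup G] [MeasurableSpace G] {μ : Measure G} {K : Set G}

/-- The integral of `|F(s)| |g(t)|` over `s + t ∈ K`, i.e. of the convolution `|F| * |g|` over
`K`. -/
def absForm (μ : Measure G) (K : Set G) (F g : G → ℂ) : ℝ≥0∞ :=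
  ∫⁻ t, ‖g t‖ₑ * ∫⁻ s, K.indicator 1 (s + t) * ‖F s‖ₑ ∂μ ∂μ

theorem absForm_congr {F F' g g' : G → ℂ} (hF : F =ᵐ[μ] F') (hg : g =ᵐ[μ] g') :
    absForm μ K F g = absForm μ K F' g' := by
  refine lintegral_congr_ae ?_
  filter_upwards [hg] with t ht
  rw [ht]
  congr 1
  refine lintegral_congr_ae ?_
  filter_upwards [hF] with s hs
  rw [hs]

theorem absForm_const_mul (a b : ℂ) (F g : G → ℂ) :
    absForm μ K (fun s => a * F s) (fun s => b * g s) = ‖a‖ₑ * ‖b‖ₑ * absForm μ K F g := by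
  simp only [absForm, enorm_mul, mul_left_comm _ ‖a‖ₑ]
  rw [← lintegral_const_mul' _ _ (ENNReal.mul_ne_top enorm_ne_top enorm_ne_top)]
  refine lintegral_congr fun t => ?_
  rw [lintegral_const_mul' _ _ enorm_ne_top]
  ring

variable [TopologicalSpace G] [IsTopologicalAddGroup G] [LocallyCompactSpace G] [T2Space G]
  [BorelSpace G] [μ.IsAddHaarMeasure] [μ.Regular]

theorem lintegral_lintegral_indicator_add_mul (hK : IsCompact K) {r : G → ℝ≥0∞}
    (hr : AEMeasurable r μ) (hri : ∫⁻ s, r s ∂μ ≠ ∞) :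
    ∫⁻ t, ∫⁻ s, K.indicator 1 (s + t) * r s ∂μ ∂μ = μ K * ∫⁻ s, r s ∂μ := by
  set c : G → ℂ := fun s => (((r s).toReal : ℝ) : ℂ) with hc
  have hcint : Integrable c μ := (integrable_toReal_of_lintegral_ne_top hr hri).ofReal
  have hcr : (fun s => ‖c s‖ₑ) =ᵐ[μ] r := by
    filter_upwards [ae_lt_top' hr hri] with s hs
    rw [hc, ← ofReal_norm, Complex.norm_real, Real.norm_of_nonneg ENNReal.toReal_nonneg,
      ENNReal.ofReal_toReal hs.ne]
  have hKint : Integrable ((-K).indicator fun _ => (1 : ℂ)) μ :=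
    (integrable_indicator_iff hK.neg.measurableSet).2
      (integrableOn_const hK.neg.measure_lt_top.ne)
  have hind (x : G) : ‖(-K).indicator (fun _ => (1 : ℂ)) x‖ₑ = (-K).indicator 1 x := by
    by_cases h : x ∈ -K <;> simp [h]
  have hneg (s t : G) : K.indicator (1 : G → ℝ≥0∞) (s + -t) = (-K).indicator 1 (t - s) := by
    have hiff : s + -t ∈ K ↔ t - s ∈ -K := by rw [Set.mem_neg, neg_sub, ← sub_eq_add_neg]
    by_cases h : s + -t ∈ K
    · rw [Set.indicator_of_mem h, Set.indicator_of_mem (hiff.1 h), Pi.one_apply, Pi.one_apply]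
    · rw [Set.indicator_of_notMem h, Set.indicator_of_notMem (hiff.not.1 h)]
  calc ∫⁻ t, ∫⁻ s, K.indicator 1 (s + t) * r s ∂μ ∂μ
      = ∫⁻ t, 1 * ∫⁻ s, ‖c s‖ₑ * ‖(-K).indicator (fun _ => (1 : ℂ)) (t - s)‖ₑ ∂μ ∂μ := by
        rw [← lintegral_neg_eq_self _ (μ := μ)]
        refine lintegral_congr fun t => ?_
        rw [one_mul]
        refine lintegral_congr_ae ?_
        filter_upwards [hcr] with s hs
        rw [hs, hind, hneg, mul_comm]
    _ = ∫⁻ s, ‖c s‖ₑ * ∫⁻ x, 1 * ‖(-K).indicator (fun _ => (1 : ℂ)) x‖ₑ ∂μ ∂μ :=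
        lintegral_mul_lconvolution hcint.aefinStronglyMeasurable hKint.aefinStronglyMeasurable
          aemeasurable_const
    _ = μ K * ∫⁻ s, r s ∂μ := by
        simp only [one_mul, hind]
        rw [lintegral_indicator_one hK.neg.measurableSet, Measure.measure_neg,
          lintegral_mul_const'' _ hcint.1.enorm, lintegral_congr_ae hcr, mul_comm]

theorem lintegral_lintegral_indicator_add_mul_le (hK : IsCompact K) {p q r : G → ℝ≥0∞}
    (hp : AEMeasurable p μ) (hq : AEMeasurable q μ) (hr : AEMeasurable r μ)
    (hri : ∫⁻ s, r s ∂μ ≠ ∞) :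
    ∫⁻ t, ∫⁻ s, K.indicator 1 (s + t) * (p s * q t + r s + q t) ∂μ ∂μ
      ≤ (∫⁻ s, p s ∂μ) * ∫⁻ t, q t ∂μ + μ K * ∫⁻ s, r s ∂μ + μ K * ∫⁻ t, q t ∂μ := by
  have hKm (t : G) : AEMeasurable (fun s => K.indicator (1 : G → ℝ≥0∞) (s + t)) μ :=
    ((measurable_one.indicator hK.measurableSet).comp (measurable_add_const t)).aemeasurable
  have hle (s : G) (a b c : ℝ≥0∞) : K.indicator 1 s * (a + b + c)
      ≤ a + K.indicator 1 s * c + K.indicator 1 s * b := by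
    by_cases h : s ∈ K <;> simp [h, add_right_comm]
  have hinner (t : G) : ∫⁻ s, K.indicator 1 (s + t) * (p s * q t + r s + q t) ∂μ
      ≤ (∫⁻ s, p s ∂μ) * q t + μ K * q t + ∫⁻ s, K.indicator 1 (s + t) * r s ∂μ := by
    have hmeas : AEMeasurable (fun s => p s * q t + K.indicator 1 (s + t) * q t) μ :=
      (hp.mul_const _).add ((hKm t).mul_const _)
    refine (lintegral_mono fun s => hle (s + t) _ _ _).trans_eq ?_
    rw [lintegral_add_left' hmeas, lintegral_add_left' (hp.mul_const _), lintegral_mul_const'' _ hp,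
      lintegral_mul_const'' _ (hKm t), lintegral_add_right_eq_self (K.indicator 1) t,
      lintegral_indicator_one hK.measurableSet]
  have hmeas : AEMeasurable (fun t => (∫⁻ s, p s ∂μ) * q t + μ K * q t) μ :=
    (hq.const_mul _).add (hq.const_mul _)
  refine (lintegral_mono hinner).trans_eq ?_
  rw [lintegral_add_left' hmeas,
    lintegral_add_left' (hq.const_mul _), lintegral_const_mul'' _ hq, lintegral_const_mul'' _ hq,
    lintegral_lintegral_indicator_add_mul hK hr hri, add_right_comm]

variable {P : YoungPair} {ω : Weight μ} {ξ : G → ℂ}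

theorem Weight.exists_neg_le_mul_of_add_mem (ω : Weight μ) (hK : IsCompact K) :
    ∃ M : ℝ≥0, ∀ s t, s + t ∈ K → ω (-s) ≤ M * ω t := by
  obtain ⟨C, hC, hsub⟩ := ω.submul
  lift C to ℝ≥0 using hC.le
  obtain ⟨L, hL⟩ := ω.exists_le_of_isCompact hK.neg
  refine ⟨C * L, fun s t hst => ?_⟩
  have hωt := (ω.pos t).le
  calc ω (-s) = ω (t + -(s + t)) := by congr 1; abel
    _ ≤ C * (ω t * ω (-(s + t))) := hsub t _
    _ ≤ C * (ω t * L) := by gcongr; exact hL _ (by simpa using hst)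
    _ = (C * L : ℝ≥0) * ω t := by push_cast; ring

theorem exists_enorm_mul_enorm_le
    (hξ : IsModularDominated P (fun s => ξ s / ((ω s * ω (-s) : ℝ) : ℂ)) μ) (hK : IsCompact K) :
    ∃ (R : ℝ≥0) (h : G → ℝ≥0∞), AEMeasurable h μ ∧ ∫⁻ s, h s ∂μ ≠ ∞ ∧
      ∀ᵐ s ∂μ, ∀ t, s + t ∈ K → ∀ a b : ℂ, ‖b‖ₑ * ‖a * ξ s‖ₑ
        ≤ R * (P.Φ ‖ω s * a‖₊ * P.Φ ‖ω t * b‖₊ + (P.Φ ‖ω s * a‖₊ + h s) + P.Φ ‖ω t * b‖₊) := by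
  obtain ⟨R, h, hh, hhi, hR⟩ := hξ
  obtain ⟨M, hM⟩ := ω.exists_neg_le_mul_of_add_mem hK
  refine ⟨M * R, h, hh, hhi, ?_⟩
  filter_upwards [hR] with s hs t hst a b
  set η : ℂ := ξ s / ((ω s * ω (-s) : ℝ) : ℂ)
  have hξη : ‖ξ s‖₊ = ‖η‖₊ * ((ω s).toNNReal * (ω (-s)).toNNReal) := by
    rw [← ω.nnnorm_ofReal, ← ω.nnnorm_ofReal, ← nnnorm_mul, ← nnnorm_mul, ← Complex.ofReal_mul,
      div_mul_cancel₀ _ (Complex.ofReal_ne_zero.2 (mul_pos (ω.pos s) (ω.pos (-s))).ne')]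
  have hω : (ω (-s)).toNNReal ≤ M * (ω t).toNNReal := by
    rw [Real.toNNReal_le_iff_le_coe]
    simpa [(ω.pos t).le] using hM s t hst
  have hprod : ‖b‖₊ * (‖a‖₊ * ‖ξ s‖₊) ≤ M * (‖η‖₊ * ‖ω s * a‖₊ * ‖ω t * b‖₊) := by
    rw [hξη, nnnorm_mul, nnnorm_mul, ω.nnnorm_ofReal, ω.nnnorm_ofReal]
    calc ‖b‖₊ * (‖a‖₊ * (‖η‖₊ * ((ω s).toNNReal * (ω (-s)).toNNReal)))
        ≤ ‖b‖₊ * (‖a‖₊ * (‖η‖₊ * ((ω s).toNNReal * (M * (ω t).toNNReal)))) := by gcongr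
      _ = _ := by ring
  rw [enorm_mul, ENNReal.coe_mul, mul_assoc]
  calc ‖b‖ₑ * (‖a‖ₑ * ‖ξ s‖ₑ) ≤ M * ((‖η‖₊ * ‖ω s * a‖₊ * ‖ω t * b‖₊ : ℝ≥0) : ℝ≥0∞) := by
        simp only [enorm_eq_nnnorm]
        exact_mod_cast hprod
    _ ≤ _ := by gcongr; exact hs _ _

/-- The form `(f, g) ↦ ∫_K |f ξ| * |g|` on `L^Φ_ω(G)` is bounded, with the constant `C`. -/
def AbsFormBound (P : YoungPair) (ω : Weight μ) (ξ : G → ℂ) (K : Set G) (C : ℝ≥0) : Prop :=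
  ∀ f g : WeightedOrliczSpace P ω,
    absForm μ K (fun s => (f : G →ₘ[μ] ℂ) s * ξ s) (g : G →ₘ[μ] ℂ) ≤ C * ‖f‖ₑ * ‖g‖ₑ

theorem exists_absForm_le_of_norm_le_one
    (hξ : IsModularDominated P (fun s => ξ s / ((ω s * ω (-s) : ℝ) : ℂ)) μ) (hK : IsCompact K) :
    ∃ C : ℝ≥0, ∀ f g : WeightedOrliczSpace P ω, ‖f‖ ≤ 1 → ‖g‖ ≤ 1 →
      absForm μ K (fun s => (f : G →ₘ[μ] ℂ) s * ξ s) (g : G →ₘ[μ] ℂ) ≤ C := by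
  obtain ⟨R, h, hh, hhi, hR⟩ := exists_enorm_mul_enorm_le hξ hK
  have hfin : (R : ℝ≥0∞) * (1 * 1 + μ K * (1 + ∫⁻ s, h s ∂μ) + μ K * 1) ≠ ∞ := by
    finiteness [hK.measure_lt_top (μ := μ) |>.ne]
  refine ⟨ENNReal.toNNReal (R * (1 * 1 + μ K * (1 + ∫⁻ s, h s ∂μ) + μ K * 1)), fun f g hf hg => ?_⟩
  rw [ENNReal.coe_toNNReal hfin]
  have hmeas (f : WeightedOrliczSpace P ω) :
      AEMeasurable (fun s => P.Φ ‖(ω s : ℂ) * (f : G →ₘ[μ] ℂ) s‖₊) μ :=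
    P.continuous_Φ.measurable.comp_aemeasurable
      (WeightedOrliczSpace.memOrlicz f).1.nnnorm.aemeasurable
  have hfi := WeightedOrliczSpace.lintegral_Φ_le_one hf
  have hgi := WeightedOrliczSpace.lintegral_Φ_le_one hg
  set p := fun s => P.Φ ‖(ω s : ℂ) * (f : G →ₘ[μ] ℂ) s‖₊
  set q := fun s => P.Φ ‖(ω s : ℂ) * (g : G →ₘ[μ] ℂ) s‖₊
  have hsum : ∫⁻ s, (p s + h s) ∂μ ≤ 1 + ∫⁻ s, h s ∂μ := by
    rw [lintegral_add_left' (hmeas f)]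
    gcongr
  calc absForm μ K (fun s => (f : G →ₘ[μ] ℂ) s * ξ s) (g : G →ₘ[μ] ℂ)
      ≤ ∫⁻ t, R * ∫⁻ s, K.indicator 1 (s + t) * (p s * q t + (p s + h s) + q t) ∂μ ∂μ := by
        refine lintegral_mono fun t => ?_
        rw [← lintegral_const_mul' _ _ enorm_ne_top, ← lintegral_const_mul' _ _ ENNReal.coe_ne_top]
        refine lintegral_mono_ae ?_
        filter_upwards [hR] with s hs
        by_cases hst : s + t ∈ K
        · rw [Set.indicator_of_mem hst, Pi.one_apply, one_mul, one_mul]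
          exact hs t hst _ _
        · simp [hst]
    _ = R * ∫⁻ t, ∫⁻ s, K.indicator 1 (s + t) * (p s * q t + (p s + h s) + q t) ∂μ ∂μ :=
        lintegral_const_mul' _ _ ENNReal.coe_ne_top
    _ ≤ R * ((∫⁻ s, p s ∂μ) * ∫⁻ t, q t ∂μ + μ K * ∫⁻ s, (p s + h s) ∂μ
          + μ K * ∫⁻ t, q t ∂μ) := by
        gcongr
        exact lintegral_lintegral_indicator_add_mul_le hK (hmeas f) (hmeas g) ((hmeas f).add hh)
          (ne_top_of_le_ne_top (by finiteness) hsum)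
    _ ≤ R * (1 * 1 + μ K * (1 + ∫⁻ s, h s ∂μ) + μ K * 1) := by gcongr

theorem exists_absFormBound
    (hξ : IsModularDominated P (fun s => ξ s / ((ω s * ω (-s) : ℝ) : ℂ)) μ) (hK : IsCompact K) :
    ∃ C, AbsFormBound P ω ξ K C := by
  obtain ⟨C, hC⟩ := exists_absForm_le_of_norm_le_one (P := P) hξ hK
  refine ⟨C, le_mul_enorm_mul_enorm_of_homogeneous (fun a b f g => ?_) hC⟩
  rw [← absForm_const_mul]
  refine absForm_congr ?_ (AEEqFun.coeFn_smul b (g : G →ₘ[μ] ℂ))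
  filter_upwards [AEEqFun.coeFn_smul a (f : G →ₘ[μ] ℂ)] with s hs
  rw [Submodule.coe_smul, hs, Pi.smul_apply, smul_eq_mul, mul_assoc]

end AbsForm

section ReflectedConvolution

variable {G : Type*} [AddCommGroup G] [MeasurableSpace G] {μ : Measure G} {U : Set G}
  {F F' f g : G → ℂ}

/-- The convolution `1_U * F̌`, where `F̌(s) = F(-s)`. -/
def reflConv (μ : Measure G) (U : Set G) (F : G → ℂ) : G → ℂ :=
  U.indicator (fun _ => (1 : ℂ)) ⋆[ContinuousLinearMap.mul ℂ ℂ, μ] fun s => F (-s)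

section MeasurableAdd

variable [MeasurableAdd G] [μ.IsAddRightInvariant]

theorem reflConv_eq_setIntegral (hU : MeasurableSet U) (F : G → ℂ) (t : G) :
    reflConv μ U F t = ∫ s in (· + t) ⁻¹' U, F s ∂μ := by
  rw [reflConv, convolution_def, ← integral_add_right_eq_self _ t,
    ← integral_indicator (measurable_add_const t hU)]
  refine integral_congr_ae (.of_forall fun s => ?_)
  by_cases h : s + t ∈ U <;> simp [h]

theorem reflConv_congr (hU : MeasurableSet U) (h : F =ᵐ[μ] F') :
    reflConv μ U F = reflConv μ U F' := by
  funext t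
  rw [reflConv_eq_setIntegral hU, reflConv_eq_setIntegral hU]
  exact integral_congr_ae (ae_restrict_of_ae h)

theorem reflConv_const_mul (hU : MeasurableSet U) (c : ℂ) (F : G → ℂ) :
    reflConv μ U (fun s => c * F s) = fun t => c * reflConv μ U F t := by
  funext t
  simp only [reflConv_eq_setIntegral hU, integral_const_mul]

theorem reflConv_preimage_add (hU : MeasurableSet U) (F : G → ℂ) (s t : G) :
    reflConv μ ((· + t) ⁻¹' U) F s = reflConv μ U F (s + t) := by
  rw [reflConv_eq_setIntegral (measurable_add_const t hU), reflConv_eq_setIntegral hU]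
  simp only [Set.preimage_preimage, add_assoc]

theorem enorm_reflConv_le (hU : MeasurableSet U) (F : G → ℂ) (t : G) :
    ‖reflConv μ U F t‖ₑ ≤ ∫⁻ s, U.indicator 1 (s + t) * ‖F s‖ₑ ∂μ := by
  rw [reflConv_eq_setIntegral hU]
  refine (enorm_integral_le_lintegral_enorm _).trans_eq ?_
  rw [← lintegral_indicator (measurable_add_const t hU)]
  refine lintegral_congr fun s => ?_
  by_cases h : s + t ∈ U <;> simp [h]

theorem lintegral_enorm_reflConv_mul_le_absForm (hU : MeasurableSet U) (F g : G → ℂ) :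
    ∫⁻ t, ‖reflConv μ U F t * g t‖ₑ ∂μ ≤ absForm μ U F g := by
  refine lintegral_mono fun t => ?_
  rw [enorm_mul, mul_comm]
  gcongr
  exact enorm_reflConv_le hU F t

theorem reflConv_indicator_eq {W V : Set G} (hU : MeasurableSet U) (hW : MeasurableSet W)
    (hWV : W + V ⊆ U) (F : G → ℂ) {t : G} (ht : t ∈ V) :
    reflConv μ U (W.indicator F) t = ∫ s in W, F s ∂μ := by
  rw [reflConv_eq_setIntegral hU, setIntegral_indicator hW, Set.inter_eq_right.2]
  exact fun s hs => hWV (Set.add_mem_add hs ht)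

end MeasurableAdd

variable [TopologicalSpace G] [IsTopologicalAddGroup G] [BorelSpace G] [T2Space G]

section RightInvariant

variable [μ.IsAddRightInvariant]

theorem convolutionExists_indicator_neg (hU : IsCompact U) (hF : LocallyIntegrable F μ) :
    ConvolutionExists (U.indicator fun _ => (1 : ℂ)) (fun s => F (-s))
      (ContinuousLinearMap.mul ℂ ℂ) μ := fun t => by
  have hK : IsCompact ((· + t) ⁻¹' U) := (Homeomorph.addRight t).isCompact_preimage.2 hU
  refine (((integrable_indicator_iff hK.measurableSet).2
    (hF.integrableOn_isCompact hK)).comp_sub_right t).congr (.of_forall fun u => ?_)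
  by_cases hu : u ∈ U <;> simp [hu]

theorem reflConv_add (hU : IsCompact U) (hF : LocallyIntegrable F μ)
    (hF' : LocallyIntegrable F' μ) :
    reflConv μ U (fun s => F s + F' s) = fun t => reflConv μ U F t + reflConv μ U F' t := by
  funext t
  have hK : IsCompact ((· + t) ⁻¹' U) := (Homeomorph.addRight t).isCompact_preimage.2 hU
  simp only [reflConv_eq_setIntegral hU.measurableSet]
  exact integral_add (hF.integrableOn_isCompact hK) (hF'.integrableOn_isCompact hK)

end RightInvariant

variable [LocallyCompactSpace G] [μ.IsAddHaarMeasure] [μ.Regular]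

theorem aestronglyMeasurable_reflConv (hU : IsCompact U) (hF : AEFinStronglyMeasurable F μ) :
    AEStronglyMeasurable (reflConv μ U F) μ := by
  have hUint : Integrable ((-U).indicator fun _ => (1 : ℂ)) μ :=
    (integrable_indicator_iff hU.neg.measurableSet).2 (integrableOn_const hU.neg.measure_lt_top.ne)
  refine ((aestronglyMeasurable_convolution hF
    hUint.aefinStronglyMeasurable).comp_quasiMeasurePreserving
      (Measure.measurePreserving_neg μ).quasiMeasurePreserving).congr (.of_forall fun t => ?_)
  rw [Function.comp_apply, reflConv_eq_setIntegral hU.measurableSet,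
    ← integral_indicator (measurable_add_const t hU.measurableSet)]
  refine integral_congr_ae (.of_forall fun s => ?_)
  have hiff : -t - s ∈ -U ↔ s + t ∈ U := by rw [Set.mem_neg, neg_sub, sub_neg_eq_add]
  by_cases h : s + t ∈ U
  · simp [h, hiff.2 h]
  · simp [h, hiff.not.2 h]

theorem setLIntegral_lconvolution (hU : MeasurableSet U) (hf : AEFinStronglyMeasurable f μ)
    (hg : AEFinStronglyMeasurable g μ) :
    ∫⁻ x in U, ∫⁻ t, ‖f t‖ₑ * ‖g (x - t)‖ₑ ∂μ ∂μ = absForm μ U g f := by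
  have hU1 : AEMeasurable (U.indicator (1 : G → ℝ≥0∞)) μ :=
    (measurable_one.indicator hU).aemeasurable
  rw [absForm, ← lintegral_mul_lconvolution hf hg hU1, ← lintegral_indicator hU]
  refine lintegral_congr fun x => ?_
  by_cases hx : x ∈ U <;> simp [hx]

theorem ae_integrable_of_absForm_lt_top (hU : MeasurableSet U) (hf : AEFinStronglyMeasurable f μ)
    (hg : AEFinStronglyMeasurable g μ) (hfg : absForm μ U g f < ∞) :
    ∀ᵐ x ∂μ.restrict U, Integrable (fun t => f t * g (x - t)) μ := by
  rw [← setLIntegral_lconvolution hU hf hg] at hfg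
  filter_upwards [ae_lt_top' (aemeasurable_lconvolution hf hg).restrict hfg.ne] with x hx
  refine ⟨(hf.aemeasurable.mul (hg.aemeasurable.comp_quasiMeasurePreserving
    (Measure.measurePreserving_sub_left μ x).quasiMeasurePreserving)).aestronglyMeasurable, ?_⟩
  simpa only [hasFiniteIntegral_iff_enorm, enorm_mul] using hx

theorem integrableOn_convolution_of_absForm_lt_top (hU : MeasurableSet U)
    (hf : AEFinStronglyMeasurable f μ) (hg : AEFinStronglyMeasurable g μ)
    (hfg : absForm μ U g f < ∞) : IntegrableOn (fun x => ∫ t, f t * g (x - t) ∂μ) U μ := by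
  refine ⟨(aestronglyMeasurable_convolution hf hg).restrict, ?_⟩
  rw [← setLIntegral_lconvolution hU hf hg] at hfg
  refine hasFiniteIntegral_iff_enorm.2 (lt_of_le_of_lt (lintegral_mono fun x => ?_) hfg)
  exact (enorm_integral_le_lintegral_enorm _).trans_eq (by simp only [enorm_mul])

theorem integral_reflConv_mul (hU : MeasurableSet U) (hf : AEFinStronglyMeasurable f μ)
    (hg : AEFinStronglyMeasurable g μ) (hfg : absForm μ U g f < ∞) :
    ∫ t, reflConv μ U g t * f t ∂μ = ∫ x in U, ∫ t, f t * g (x - t) ∂μ ∂μ := by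
  have hind (x : G) : ‖U.indicator (1 : G → ℂ) x‖ₑ = U.indicator 1 x := by
    by_cases hx : x ∈ U <;> simp [hx]
  have hmul (x : G) (z : ℂ) : U.indicator (1 : G → ℂ) x * z = U.indicator (fun _ => z) x := by
    by_cases hx : x ∈ U <;> simp [hx]
  have hU1 : AEMeasurable (U.indicator (1 : G → ℂ)) μ :=
    (measurable_one.indicator hU).aemeasurable
  have hfubini := integral_mul_convolution hf hg hU1 (by simpa only [absForm, hind] using hfg)
  rw [← integral_indicator hU]
  refine Eq.trans (integral_congr_ae (.of_forall fun t => ?_)) (hfubini.symm.trans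
    (integral_congr_ae (.of_forall fun x => hmul x _)))
  simp only [hmul]
  rw [reflConv_eq_setIntegral hU, mul_comm, ← integral_indicator (measurable_add_const t hU)]
  rfl

end ReflectedConvolution

section Derivation

theorem convolution_mul_map {G : Type*} [AddCommGroup G] [MeasurableSpace G] [MeasurableAdd G]
    [MeasurableNeg G] {μ : Measure G} [μ.IsAddLeftInvariant] [μ.IsNegInvariant] (ξ : G →+ ℂ)
    {f g : G → ℂ} {x : G} (hf : Integrable (fun t => f t * (g (x - t) * ξ (x - t))) μ)
    (hg : Integrable (fun t => g t * (f (x - t) * ξ (x - t))) μ) :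
    (∫ t, f t * g (x - t) ∂μ) * ξ x = ∫ t, f t * (g (x - t) * ξ (x - t)) ∂μ
      + ∫ t, g t * (f (x - t) * ξ (x - t)) ∂μ := by
  have hg' := hg.comp_sub_left x
  rw [← integral_sub_left_eq_self (fun t => g t * (f (x - t) * ξ (x - t))) μ x,
    ← integral_add hf hg', ← integral_mul_const]
  refine integral_congr_ae (.of_forall fun t => ?_)
  simp only [map_sub, sub_sub_cancel]
  ring

variable {G : Type*} [AddCommGroup G] [TopologicalSpace G] [MeasurableSpace G] {μ : Measure G}
  {P : YoungPair} {ω : Weight μ} {U : Set G}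

section Bound

variable {ξ : G → ℂ} {C : ℝ≥0}

theorem AbsFormBound.lt_top (hC : AbsFormBound P ω ξ U C) (f g : WeightedOrliczSpace P ω) :
    absForm μ U (fun s => (f : G →ₘ[μ] ℂ) s * ξ s) (g : G →ₘ[μ] ℂ) < ∞ :=
  (hC f g).trans_lt (by finiteness)

variable [MeasurableAdd G] [μ.IsAddRightInvariant]

theorem AbsFormBound.norm_integral_reflConv_mul_le (hC : AbsFormBound P ω ξ U C)
    (hU : MeasurableSet U) (f g : WeightedOrliczSpace P ω) :
    ‖∫ t, reflConv μ U (fun s => (f : G →ₘ[μ] ℂ) s * ξ s) t * (g : G →ₘ[μ] ℂ) t ∂μ‖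
      ≤ C * ‖f‖ * ‖g‖ := by
  have hle := (enorm_integral_le_lintegral_enorm _).trans
    ((lintegral_enorm_reflConv_mul_le_absForm hU _ _).trans (hC f g))
  simp only [enorm_eq_nnnorm] at hle
  exact_mod_cast hle

theorem reflConv_coe_smul_mul (hU : MeasurableSet U) (c : ℂ) (f : WeightedOrliczSpace P ω) :
    reflConv μ U (fun s => ((c • f : WeightedOrliczSpace P ω) : G →ₘ[μ] ℂ) s * ξ s)
      = fun t => c * reflConv μ U (fun s => (f : G →ₘ[μ] ℂ) s * ξ s) t := by
  rw [← reflConv_const_mul hU]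
  refine reflConv_congr hU ?_
  filter_upwards [AEEqFun.coeFn_smul c (f : G →ₘ[μ] ℂ)] with s hs
  rw [Submodule.coe_smul, hs, Pi.smul_apply, smul_eq_mul, mul_assoc]

end Bound

variable [IsTopologicalAddGroup G] [LocallyCompactSpace G] [BorelSpace G] [μ.IsAddHaarMeasure]

theorem reflConv_coe_add_mul [T2Space G] (hU : IsCompact U) {ξ : G → ℂ} (hξ : Continuous ξ)
    (f f' : WeightedOrliczSpace P ω) :
    reflConv μ U (fun s => ((f + f' : WeightedOrliczSpace P ω) : G →ₘ[μ] ℂ) s * ξ s)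
      = fun t => reflConv μ U (fun s => (f : G →ₘ[μ] ℂ) s * ξ s) t
        + reflConv μ U (fun s => (f' : G →ₘ[μ] ℂ) s * ξ s) t := by
  have hloc (f : WeightedOrliczSpace P ω) :
      LocallyIntegrable (fun s => (f : G →ₘ[μ] ℂ) s * ξ s) μ :=
    (WeightedOrliczSpace.locallyIntegrable f).mul_continuous hξ
  rw [← reflConv_add hU (hloc f) (hloc f')]
  refine reflConv_congr hU.measurableSet ?_
  filter_upwards [AEEqFun.coeFn_add (f : G →ₘ[μ] ℂ) f'] with s hs
  rw [Submodule.coe_add, hs, Pi.add_apply, add_mul]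

variable [μ.Regular]
  {m : WeightedOrliczSpace P ω →L[ℂ] WeightedOrliczSpace P ω →L[ℂ] WeightedOrliczSpace P ω}

theorem IsConvolutionProduct.exists_enorm_ae_eq_lconvolution (hm : IsConvolutionProduct P ω m)
    (f g : WeightedOrliczSpace P ω) :
    ∃ h : WeightedOrliczSpace P ω, ∀ᵐ x ∂μ, ‖(h : G →ₘ[μ] ℂ) x‖ₑ
      = ∫⁻ t, ‖(f : G →ₘ[μ] ℂ) t‖ₑ * ‖(g : G →ₘ[μ] ℂ) (x - t)‖ₑ ∂μ := by
  obtain ⟨f', hf'⟩ := WeightedOrliczSpace.exists_coe_ae_eq_norm f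
  obtain ⟨g', hg'⟩ := WeightedOrliczSpace.exists_coe_ae_eq_norm g
  refine ⟨m f' g', ?_⟩
  filter_upwards [hm.coe_eq f' g', (hm f g).1] with x hx hex
  have hnorm : (fun t => (f' : G →ₘ[μ] ℂ) t * (g' : G →ₘ[μ] ℂ) (x - t)) =ᵐ[μ]
      fun t => ((‖(f : G →ₘ[μ] ℂ) t * (g : G →ₘ[μ] ℂ) (x - t)‖ : ℝ) : ℂ) := by
    filter_upwards [hf', (Measure.measurePreserving_sub_left μ x).quasiMeasurePreserving.ae hg']
      with t hft hgt
    rw [hft, hgt, norm_mul, Complex.ofReal_mul]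
  have hint : Integrable (fun t => (f : G →ₘ[μ] ℂ) t * (g : G →ₘ[μ] ℂ) (x - t)) μ := hex
  rw [hx, integral_congr_ae hnorm, integral_complex_ofReal, ← ofReal_norm, Complex.norm_real,
    Real.norm_of_nonneg (integral_nonneg fun _ => norm_nonneg _),
    ofReal_integral_norm_eq_lintegral_enorm hint]
  simp only [enorm_mul]

variable [T2Space G]

theorem AbsFormBound.integrable_reflConv_mul {ξ : G → ℂ} {C : ℝ≥0}
    (hC : AbsFormBound P ω ξ U C) (hU : IsCompact U) (hξ : Continuous ξ)
    (f g : WeightedOrliczSpace P ω) :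
    Integrable (fun t => reflConv μ U (fun s => (f : G →ₘ[μ] ℂ) s * ξ s) t
      * (g : G →ₘ[μ] ℂ) t) μ :=
  ⟨(aestronglyMeasurable_reflConv hU (WeightedOrliczSpace.aefinStronglyMeasurable_mul f
      hξ.aestronglyMeasurable)).mul (AEEqFun.aestronglyMeasurable _),
    hasFiniteIntegral_iff_enorm.2
      ((lintegral_enorm_reflConv_mul_le_absForm hU.measurableSet _ _).trans_lt (hC.lt_top f g))⟩

/-- The bounded bilinear form `(f, g) ↦ ∫ (1_U * (f̌ ξ̌)) g` on `L^Φ_ω(G)`, i.e. the operator `D` of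
the theorem as a map into the dual space. -/
def derivationForm (hU : IsCompact U) {ξ : G → ℂ} (hξ : Continuous ξ) {C : ℝ≥0}
    (hC : AbsFormBound P ω ξ U C) :
    WeightedOrliczSpace P ω →L[ℂ] WeightedOrliczSpace P ω →L[ℂ] ℂ :=
  LinearMap.mkContinuous₂
    (LinearMap.mk₂ ℂ (fun f g : WeightedOrliczSpace P ω =>
      ∫ t, reflConv μ U (fun s => (f : G →ₘ[μ] ℂ) s * ξ s) t * (g : G →ₘ[μ] ℂ) t ∂μ)
      (fun f f' g => by
        simp only [reflConv_coe_add_mul hU hξ, add_mul]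
        exact integral_add (hC.integrable_reflConv_mul hU hξ f g)
          (hC.integrable_reflConv_mul hU hξ f' g))
      (fun c f g => by
        simp only [reflConv_coe_smul_mul hU.measurableSet, mul_assoc, smul_eq_mul,
          integral_const_mul])
      (fun f g g' => by
        rw [← integral_add (hC.integrable_reflConv_mul hU hξ f g)
          (hC.integrable_reflConv_mul hU hξ f g')]
        refine integral_congr_ae ?_
        filter_upwards [AEEqFun.coeFn_add (g : G →ₘ[μ] ℂ) g'] with t ht
        rw [Submodule.coe_add, ht, Pi.add_apply, mul_add])
      (fun c f g => by
        rw [smul_eq_mul, ← integral_const_mul]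
        refine integral_congr_ae ?_
        filter_upwards [AEEqFun.coeFn_smul c (g : G →ₘ[μ] ℂ)] with t ht
        rw [Submodule.coe_smul, ht, Pi.smul_apply, smul_eq_mul, mul_left_comm]))
    C (hC.norm_integral_reflConv_mul_le hU.measurableSet)

theorem derivationForm_apply (hU : IsCompact U) {ξ : G → ℂ} (hξ : Continuous ξ) {C : ℝ≥0}
    (hC : AbsFormBound P ω ξ U C) (f g : WeightedOrliczSpace P ω) :
    derivationForm hU hξ hC f g
      = ∫ t, reflConv μ U (fun s => (f : G →ₘ[μ] ℂ) s * ξ s) t * (g : G →ₘ[μ] ℂ) t ∂μ := rfl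

namespace IsConvolutionProduct

theorem lintegral_mul_reflConv_lt_top (hm : IsConvolutionProduct P ω m) (hU : IsCompact U)
    {ξ : G → ℂ} (hξ : Continuous ξ) {C : ℝ≥0} (hC : AbsFormBound P ω ξ U C)
    (a b c : WeightedOrliczSpace P ω) :
    ∫⁻ t, ‖(c : G →ₘ[μ] ℂ) t‖ₑ
      * ∫⁻ x, ‖reflConv μ U (fun s => (a : G →ₘ[μ] ℂ) s * ξ s) (x + t)‖ₑ
        * ‖(b : G →ₘ[μ] ℂ) x‖ₑ ∂μ ∂μ < ∞ := by
  obtain ⟨h, hh⟩ := hm.exists_enorm_ae_eq_lconvolution c b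
  have hmeas := aestronglyMeasurable_reflConv hU
    (WeightedOrliczSpace.aefinStronglyMeasurable_mul a hξ.aestronglyMeasurable)
  rw [← lintegral_mul_lconvolution (WeightedOrliczSpace.aefinStronglyMeasurable c)
    (WeightedOrliczSpace.aefinStronglyMeasurable b) hmeas.enorm]
  refine lt_of_eq_of_lt (lintegral_congr_ae ?_)
    ((lintegral_enorm_reflConv_mul_le_absForm hU.measurableSet _ _).trans_lt (hC.lt_top a h))
  filter_upwards [hh] with x hx
  rw [enorm_mul, hx]

theorem derivationForm_mul (hm : IsConvolutionProduct P ω m) (hU : IsCompact U) {ξ : G → ℂ}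
    (hξ : Continuous ξ) {C : ℝ≥0} (hC : AbsFormBound P ω ξ U C) (a b c : WeightedOrliczSpace P ω) :
    derivationForm hU hξ hC a (m c b) = ∫ t, (c : G →ₘ[μ] ℂ) t
      * ∫ x, reflConv μ U (fun s => (a : G →ₘ[μ] ℂ) s * ξ s) (x + t) * (b : G →ₘ[μ] ℂ) x ∂μ ∂μ := by
  have hmeas := aestronglyMeasurable_reflConv hU
    (WeightedOrliczSpace.aefinStronglyMeasurable_mul a hξ.aestronglyMeasurable)
  rw [derivationForm_apply, ← integral_mul_convolution
    (WeightedOrliczSpace.aefinStronglyMeasurable c) (WeightedOrliczSpace.aefinStronglyMeasurable b)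
    hmeas.aemeasurable (hm.lintegral_mul_reflConv_lt_top hU hξ hC a b c)]
  refine integral_congr_ae ?_
  filter_upwards [hm.coe_eq c b] with x hx
  rw [hx]

variable {ξ : G →+ ℂ}

theorem reflConv_mul (hm : IsConvolutionProduct P ω m) (hξ : Continuous ξ) (hU : IsCompact U)
    (hbound : ∀ K : Set G, IsCompact K → ∃ C, AbsFormBound P ω ξ K C)
    (a b : WeightedOrliczSpace P ω) (t : G) :
    reflConv μ U (fun s => (m a b : G →ₘ[μ] ℂ) s * ξ s) t
      = ∫ x, reflConv μ U (fun s => (b : G →ₘ[μ] ℂ) s * ξ s) (x + t) * (a : G →ₘ[μ] ℂ) x ∂μ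
        + ∫ x, reflConv μ U (fun s => (a : G →ₘ[μ] ℂ) s * ξ s) (x + t)
          * (b : G →ₘ[μ] ℂ) x ∂μ := by
  have hK : IsCompact ((· + t) ⁻¹' U) := (Homeomorph.addRight t).isCompact_preimage.2 hU
  obtain ⟨C, hC⟩ := hbound _ hK
  have hmeas (f : WeightedOrliczSpace P ω) := WeightedOrliczSpace.aefinStronglyMeasurable f
  have hmeasξ (f : WeightedOrliczSpace P ω) :=
    WeightedOrliczSpace.aefinStronglyMeasurable_mul f (g := ξ) hξ.aestronglyMeasurable
  have hconv (f g : WeightedOrliczSpace P ω) :=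
    integrableOn_convolution_of_absForm_lt_top hK.measurableSet (hmeas f) (hmeasξ g) (hC.lt_top g f)
  have hint (f g : WeightedOrliczSpace P ω) :=
    ae_integrable_of_absForm_lt_top hK.measurableSet (hmeas f) (hmeasξ g) (hC.lt_top g f)
  simp only [← reflConv_preimage_add hU.measurableSet]
  rw [integral_reflConv_mul hK.measurableSet (hmeas a) (hmeasξ b) (hC.lt_top b a),
    integral_reflConv_mul hK.measurableSet (hmeas b) (hmeasξ a) (hC.lt_top a b),
    ← integral_add (hconv a b) (hconv b a), reflConv_eq_setIntegral hU.measurableSet]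
  refine integral_congr_ae ?_
  filter_upwards [ae_restrict_of_ae (hm.coe_eq a b), hint a b, hint b a] with x hx hab hba
  rw [hx]
  exact convolution_mul_map ξ hab hba

theorem isDerivation_derivationForm (hm : IsConvolutionProduct P ω m) (hξ : Continuous ξ)
    (hU : IsCompact U) (hbound : ∀ K : Set G, IsCompact K → ∃ C, AbsFormBound P ω ξ K C)
    {C : ℝ≥0} (hC : AbsFormBound P ω ξ U C) : IsDerivation m (derivationForm hU hξ hC) := by
  intro a b c
  have hint (f g : WeightedOrliczSpace P ω) := integrable_mul_integral_comp_add_mul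
    (WeightedOrliczSpace.aefinStronglyMeasurable c) (WeightedOrliczSpace.aefinStronglyMeasurable g)
    (aestronglyMeasurable_reflConv hU (WeightedOrliczSpace.aefinStronglyMeasurable_mul f
      hξ.aestronglyMeasurable)).aemeasurable (hm.lintegral_mul_reflConv_lt_top hU hξ hC f g c)
  rw [hm.comm b c, hm.derivationForm_mul, hm.derivationForm_mul,
    ← integral_add (hint b a) (hint a b), derivationForm_apply]
  refine integral_congr_ae (.of_forall fun t => ?_)
  simp only [hm.reflConv_mul hξ hU hbound a b]
  ring

end IsConvolutionProduct

end Derivation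

section NotInner

variable {A : Type*} [NormedAddCommGroup A] [NormedSpace ℂ A] {m : A →L[ℂ] A →L[ℂ] A}
  {D : A →L[ℂ] A →L[ℂ] ℂ}

theorem not_isInner_of_comm (hcomm : ∀ a b, m a b = m b a) {a c : A} (h : D a c ≠ 0) :
    ¬ IsInner m D := by
  rintro ⟨φ, hφ⟩
  exact h (by rw [hφ, hcomm, sub_self])

variable {S : Submodule ℂ A} {mS : S →L[ℂ] S →L[ℂ] S}

theorem IsDerivation.bilinearComp_subtypeL (hD : IsDerivation m D)
    (hmS : ∀ a b : S, (mS a b : A) = m a b) :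
    IsDerivation mS (D.bilinearComp S.subtypeL S.subtypeL) := fun a b c => by
  simpa [hmS] using hD a b c

theorem not_isInner_bilinearComp_subtypeL (hcomm : ∀ a b, m a b = m b a)
    (hmS : ∀ a b : S, (mS a b : A) = m a b) {a c : A} (ha : a ∈ S) (hc : c ∈ S) (h : D a c ≠ 0) :
    ¬ IsInner mS (D.bilinearComp S.subtypeL S.subtypeL) :=
  not_isInner_of_comm (fun a b => Subtype.ext (by rw [hmS, hmS, hcomm]))
    (a := ⟨a, ha⟩) (c := ⟨c, hc⟩) h

end NotInner

section Nonvanishing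

theorem exists_isCompact_add_subset {G : Type*} [AddGroup G] [TopologicalSpace G]
    [ContinuousAdd G] [LocallyCompactSpace G] {U : Set G} (hU : U ∈ 𝓝 0) (x : G) :
    ∃ W ∈ 𝓝 x, ∃ V ∈ 𝓝 (-x), IsCompact W ∧ IsCompact V ∧ W + V ⊆ U := by
  have hadd : (fun p : G × G => p.1 + p.2) ⁻¹' U ∈ 𝓝 x ×ˢ 𝓝 (-x) := by
    rw [← nhds_prod_eq]
    exact continuous_add.continuousAt.preimage_mem_nhds (by simpa using hU)
  obtain ⟨A, hA, B, hB, hAB⟩ := mem_prod_iff.1 hadd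
  obtain ⟨W, hWx, hWA, hW⟩ := local_compact_nhds hA
  obtain ⟨V, hVx, hVB, hV⟩ := local_compact_nhds hB
  refine ⟨W, hWx, V, hVx, hW, hV, Set.add_subset_iff.2 fun w hw v hv => ?_⟩
  exact hAB (Set.mk_mem_prod (hWA hw) (hVB hv))

theorem setIntegral_conj_mul_self_ne_zero {X : Type*} [TopologicalSpace X] [MeasurableSpace X]
    [OpensMeasurableSpace X] [T2Space X] {μ : Measure X} [IsFiniteMeasureOnCompacts μ]
    [μ.IsOpenPosMeasure] {f : X → ℂ} (hf : Continuous f) {W : Set X} (hW : IsCompact W) {x : X}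
    (hWx : W ∈ 𝓝 x) (hx : f x ≠ 0) : ∫ s in W, starRingEnd ℂ (f s) * f s ∂μ ≠ 0 := by
  have hcont : Continuous fun s => ‖f s‖ ^ 2 := by fun_prop
  have hpos : 0 < ∫ s in W, ‖f s‖ ^ 2 ∂μ := by
    rw [setIntegral_pos_iff_support_of_nonneg_ae (.of_forall fun s => by positivity)
      (hcont.continuousOn.integrableOn_compact hW)]
    refine Measure.measure_pos_of_mem_nhds μ (inter_mem ?_ hWx)
    filter_upwards [hf.continuousAt.eventually_ne hx] with s hs
    simpa using hs
  simp only [← Complex.normSq_eq_conj_mul_self, Complex.normSq_eq_norm_sq]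
  rw [integral_complex_ofReal]
  exact Complex.ofReal_ne_zero.2 hpos.ne'

variable {G : Type*} [AddCommGroup G] [MeasurableSpace G] {μ : Measure G}

theorem integral_reflConv_indicator_mul_indicator [MeasurableAdd G] [μ.IsAddRightInvariant]
    {U W V : Set G} (hU : MeasurableSet U) (hW : MeasurableSet W) (hV : MeasurableSet V)
    (hWV : W + V ⊆ U) (F : G → ℂ) :
    ∫ t, reflConv μ U (W.indicator F) t * V.indicator (fun _ => 1) t ∂μ
      = μ.real V * ∫ s in W, F s ∂μ := by
  have hconst (t : G) : reflConv μ U (W.indicator F) t * V.indicator (fun _ => 1) t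
      = V.indicator (fun _ => ∫ s in W, F s ∂μ) t := by
    by_cases ht : t ∈ V
    · simp [ht, reflConv_indicator_eq hU hW hWV F ht]
    · simp [ht]
  simp only [hconst]
  rw [integral_indicator_const _ hV, Complex.real_smul]

variable [TopologicalSpace G] [IsTopologicalAddGroup G] [LocallyCompactSpace G] [T2Space G]
  [BorelSpace G] [μ.IsAddHaarMeasure] [μ.Regular] {P : YoungPair} {ω : Weight μ}

theorem exists_mem_boundedCompact_ae_eq_indicator {f : G → ℂ} (hf : Continuous f) {K : Set G}
    (hK : IsCompact K) : ∃ g ∈ BoundedCompact P ω, (g : G →ₘ[μ] ℂ) =ᵐ[μ] K.indicator f := by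
  obtain ⟨M, hM⟩ := hK.exists_bound_of_continuousOn hf.continuousOn
  refine exists_mem_boundedCompact_coe_ae_eq
    (hf.aestronglyMeasurable.indicator hK.measurableSet) hK (M := M.toNNReal)
    (.of_forall fun x => ?_)
  by_cases hx : x ∈ K
  · simpa only [Set.indicator_of_mem hx] using NNReal.le_toNNReal_of_coe_le (hM x hx)
  · simp [hx]

theorem exists_integral_reflConv_mul_ne_zero {ξ : G → ℂ} (hξ : Continuous ξ) {x : G}
    (hx : ξ x ≠ 0) {U : Set G} (hU : MeasurableSet U) (hU0 : U ∈ 𝓝 0) :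
    ∃ f ∈ BoundedCompact P ω, ∃ g ∈ BoundedCompact P ω,
      ∫ t, reflConv μ U (fun s => (f : G →ₘ[μ] ℂ) s * ξ s) t * (g : G →ₘ[μ] ℂ) t ∂μ ≠ 0 := by
  obtain ⟨W, hWx, V, hVx, hW, hV, hWV⟩ := exists_isCompact_add_subset hU0 x
  obtain ⟨f, hf, hfW⟩ := exists_mem_boundedCompact_ae_eq_indicator (P := P) (ω := ω)
    (Complex.continuous_conj.comp hξ) hW
  obtain ⟨g, hg, hgV⟩ := exists_mem_boundedCompact_ae_eq_indicator (P := P) (ω := ω)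
    (continuous_const (y := (1 : ℂ))) hV
  refine ⟨f, hf, g, hg, ?_⟩
  have hfξ : (fun s => (f : G →ₘ[μ] ℂ) s * ξ s) =ᵐ[μ]
      W.indicator fun s => starRingEnd ℂ (ξ s) * ξ s := by
    filter_upwards [hfW] with s hs
    rw [hs, Set.indicator_mul_left]
    rfl
  have hval : ∫ t, reflConv μ U (fun s => (f : G →ₘ[μ] ℂ) s * ξ s) t * (g : G →ₘ[μ] ℂ) t ∂μ
      = μ.real V * ∫ s in W, starRingEnd ℂ (ξ s) * ξ s ∂μ := by
    rw [reflConv_congr hU hfξ, ← integral_reflConv_indicator_mul_indicator hU hW.measurableSet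
      hV.measurableSet hWV]
    exact integral_congr_ae (hgV.mono fun t ht => by simp only [ht])
  rw [hval]
  refine mul_ne_zero (Complex.ofReal_ne_zero.2 ?_) (setIntegral_conj_mul_self_ne_zero hξ hW hWx hx)
  exact (ENNReal.toReal_pos (Measure.measure_pos_of_mem_nhds μ hVx).ne' hV.measure_lt_top.ne).ne'

end Nonvanishing

theorem YoungPair.exists_Ψ_le_mul_sq (P : YoungPair)
    (h : IsYoung fun x => P.Ψ (NNReal.sqrt x)) :
    ∃ c : ℝ≥0, ∀ y ≤ 1, P.Ψ y ≤ c * (y : ℝ≥0∞) ^ 2 := by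
  refine ⟨(P.Ψ 1).toNNReal, fun y hy => (h.le_sq_mul hy).trans_eq ?_⟩
  rw [ENNReal.coe_toNNReal (P.Ψ_ne_top 1), ENNReal.coe_pow, mul_comm]

namespace IsConvolutionProduct

variable {G : Type*} [AddCommGroup G] [TopologicalSpace G] [IsTopologicalAddGroup G]
  [LocallyCompactSpace G] [T2Space G] [MeasurableSpace G] [BorelSpace G] {μ : Measure G}
  [μ.IsAddHaarMeasure] [μ.Regular] {P : YoungPair} {ω : Weight μ}
  {m : WeightedOrliczSpace P ω →L[ℂ] WeightedOrliczSpace P ω →L[ℂ] WeightedOrliczSpace P ω}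
  {ξ : G → ℂ} {x : G} {U : Set G} {C : ℝ≥0}

theorem not_isInner_derivationForm (hm : IsConvolutionProduct P ω m) (hξ : Continuous ξ)
    (hx : ξ x ≠ 0) (hU : IsCompact U) (hU0 : U ∈ 𝓝 0) (hC : AbsFormBound P ω ξ U C) :
    ¬ IsInner m (derivationForm hU hξ hC) := by
  obtain ⟨f, -, g, -, h⟩ := exists_integral_reflConv_mul_ne_zero (P := P) (ω := ω) hξ hx
    hU.measurableSet hU0
  exact not_isInner_of_comm hm.comm (a := f) (c := g) h

theorem not_isInner_restrict_derivationForm (hm : IsConvolutionProduct P ω m) (hξ : Continuous ξ)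
    (hx : ξ x ≠ 0) (hU : IsCompact U) (hU0 : U ∈ 𝓝 0) (hC : AbsFormBound P ω ξ U C) :
    ¬ IsInner hm.restrict ((derivationForm hU hξ hC).bilinearComp
      (WeightedStepClosure P ω).subtypeL (WeightedStepClosure P ω).subtypeL) := by
  obtain ⟨f, hf, g, hg, h⟩ := exists_integral_reflConv_mul_ne_zero (P := P) (ω := ω) hξ hx
    hU.measurableSet hU0
  exact not_isInner_bilinearComp_subtypeL hm.comm (fun _ _ => rfl)
    (boundedCompact_le_weightedStepClosure hf) (boundedCompact_le_weightedStepClosure hg) h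

end IsConvolutionProduct

end WeightedOrlicz

end

open WeightedOrlicz in
theorem mainTheorem2_general {G : Type*} [AddCommGroup G] [TopologicalSpace G]
    [IsTopologicalAddGroup G] [LocallyCompactSpace G] [T2Space G] [MeasurableSpace G] [BorelSpace G]
    (μ : Measure G) [μ.IsAddHaarMeasure] [μ.Regular]
    (P : YoungPair) (ω : Weight μ)
    (m : WeightedOrliczSpace P ω →L[ℂ] WeightedOrliczSpace P ω →L[ℂ] WeightedOrliczSpace P ω)
    (hm : IsConvolutionProduct P ω m)
    (ξ : G →+ ℂ) (hξ : Continuous ξ) (hξ0 : ξ ≠ 0)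
    (hcase : (MemLp (fun s => ξ s / ((ω s * ω (-s) : ℝ) : ℂ)) ∞ μ ∧
        ∃ c : ℝ≥0, ∀ y ≤ 1, P.Ψ y ≤ c * (y : ℝ≥0∞) ^ 2) ∨
      MemOrlicz (complementary (fun x => P.Φ (NNReal.sqrt x)))
        (fun s => ξ s / ((ω s * ω (-s) : ℝ) : ℂ)) μ) :
    ∃ mS : WeightedStepClosure P ω →L[ℂ] WeightedStepClosure P ω →L[ℂ] WeightedStepClosure P ω,
      (∀ f g : WeightedStepClosure P ω, (mS f g : WeightedOrliczSpace P ω) = m f g) ∧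
      ¬ IsWeaklyAmenable m ∧
      ¬ IsWeaklyAmenable mS ∧
      ∀ U : Set G, IsCompact U → U ∈ 𝓝 (0 : G) →
        ∃ (D : WeightedOrliczSpace P ω →L[ℂ] WeightedOrliczSpace P ω →L[ℂ] ℂ)
          (DS : WeightedStepClosure P ω →L[ℂ] WeightedStepClosure P ω →L[ℂ] ℂ),
          (∀ f : WeightedOrliczSpace P ω,
            ConvolutionExists (U.indicator (fun _ => (1 : ℂ)))
              (fun s => (f : G →ₘ[μ] ℂ) (-s) * ξ (-s)) (ContinuousLinearMap.mul ℂ ℂ) μ) ∧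
          (∀ f g : WeightedOrliczSpace P ω,
            Integrable (fun t => (U.indicator (fun _ => (1 : ℂ))
              ⋆[ContinuousLinearMap.mul ℂ ℂ, μ]
                (fun s => (f : G →ₘ[μ] ℂ) (-s) * ξ (-s))) t * (g : G →ₘ[μ] ℂ) t) μ ∧
            D f g = ∫ t, (U.indicator (fun _ => (1 : ℂ))
              ⋆[ContinuousLinearMap.mul ℂ ℂ, μ]
                (fun s => (f : G →ₘ[μ] ℂ) (-s) * ξ (-s))) t * (g : G →ₘ[μ] ℂ) t ∂μ) ∧
          (∀ f g : WeightedStepClosure P ω, DS f g = D f g) ∧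
          IsDerivation m D ∧ ¬ IsInner m D ∧
          IsDerivation mS DS ∧ ¬ IsInner mS DS := by
  have hdom : IsModularDominated P (fun s => ξ s / ((ω s * ω (-s) : ℝ) : ℂ)) μ := by
    rcases hcase with ⟨hbdd, c, hc⟩ | hη
    exacts [isModularDominated_of_memLp_top hbdd hc, isModularDominated_of_memOrlicz hη]
  choose C hC using fun (K : Set G) (hK : IsCompact K) => exists_absFormBound hdom hK
  obtain ⟨x, hx⟩ := DFunLike.ne_iff.1 hξ0
  have hder (U : Set G) (hU : IsCompact U) := hm.isDerivation_derivationForm hξ hU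
    (fun K hK => ⟨C K hK, hC K hK⟩) (hC U hU)
  have hderS (U : Set G) (hU : IsCompact U) :=
    (hder U hU).bilinearComp_subtypeL (mS := hm.restrict) fun _ _ => rfl
  have hinner (U : Set G) (hU : IsCompact U) (hU0 : U ∈ 𝓝 0) :=
    hm.not_isInner_derivationForm hξ hx hU hU0 (hC U hU)
  have hinnerS (U : Set G) (hU : IsCompact U) (hU0 : U ∈ 𝓝 0) :=
    hm.not_isInner_restrict_derivationForm hξ hx hU hU0 (hC U hU)
  have hconv (U : Set G) (hU : IsCompact U) (f : WeightedOrliczSpace P ω) :=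
    convolutionExists_indicator_neg hU
      ((WeightedOrliczSpace.locallyIntegrable f).mul_continuous hξ)
  obtain ⟨U₀, hU₀, h0⟩ := exists_compact_mem_nhds (0 : G)
  refine ⟨hm.restrict, fun _ _ => rfl, fun h => hinner U₀ hU₀ h0 (h _ (hder U₀ hU₀)),
    fun h => hinnerS U₀ hU₀ h0 (h _ (hderS U₀ hU₀)), fun U hU hU0 =>
    ⟨derivationForm hU hξ (hC U hU), _, hconv U hU,
      fun f g => ⟨(hC U hU).integrable_reflConv_mul hU hξ f g, derivationForm_apply ..⟩,
      fun _ _ => rfl, hder U hU, hinner U hU hU0, hderS U hU, hinnerS U hU hU0⟩⟩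

open WeightedOrlicz in
theorem mainTheorem2 {G : Type*} [AddCommGroup G] [TopologicalSpace G] [IsTopologicalAddGroup G]
    [LocallyCompactSpace G] [T2Space G] [MeasurableSpace G] [BorelSpace G]
    (μ : Measure G) [μ.IsAddHaarMeasure] [μ.Regular]
    (P : YoungPair) (ω : Weight μ)
    (m : WeightedOrliczSpace P ω →L[ℂ] WeightedOrliczSpace P ω →L[ℂ] WeightedOrliczSpace P ω)
    (hm : IsConvolutionProduct P ω m)
    (ξ : G →+ ℂ) (hξ : Continuous ξ) (hξ0 : ξ ≠ 0)
    (hbdd : MemLp (fun s => ξ s / ((ω s * ω (-s) : ℝ) : ℂ)) ∞ μ)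
    (hcase : IsYoung (fun x => P.Ψ (NNReal.sqrt x)) ∨
      (IsYoung (fun x => P.Φ (NNReal.sqrt x)) ∧
        MemOrlicz (complementary (fun x => P.Φ (NNReal.sqrt x)))
          (fun s => ξ s / ((ω s * ω (-s) : ℝ) : ℂ)) μ)) :
    ∃ mS : WeightedStepClosure P ω →L[ℂ] WeightedStepClosure P ω →L[ℂ] WeightedStepClosure P ω,
      (∀ f g : WeightedStepClosure P ω, (mS f g : WeightedOrliczSpace P ω) = m f g) ∧
      ¬ IsWeaklyAmenable m ∧
      ¬ IsWeaklyAmenable mS ∧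
      ∀ U : Set G, IsCompact U → U ∈ 𝓝 (0 : G) →
        ∃ (D : WeightedOrliczSpace P ω →L[ℂ] WeightedOrliczSpace P ω →L[ℂ] ℂ)
          (DS : WeightedStepClosure P ω →L[ℂ] WeightedStepClosure P ω →L[ℂ] ℂ),
          (∀ f : WeightedOrliczSpace P ω,
            ConvolutionExists (U.indicator (fun _ => (1 : ℂ)))
              (fun s => (f : G →ₘ[μ] ℂ) (-s) * ξ (-s)) (ContinuousLinearMap.mul ℂ ℂ) μ) ∧
          (∀ f g : WeightedOrliczSpace P ω,
            Integrable (fun t => (U.indicator (fun _ => (1 : ℂ))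
              ⋆[ContinuousLinearMap.mul ℂ ℂ, μ]
                (fun s => (f : G →ₘ[μ] ℂ) (-s) * ξ (-s))) t * (g : G →ₘ[μ] ℂ) t) μ ∧
            D f g = ∫ t, (U.indicator (fun _ => (1 : ℂ))
              ⋆[ContinuousLinearMap.mul ℂ ℂ, μ]
                (fun s => (f : G →ₘ[μ] ℂ) (-s) * ξ (-s))) t * (g : G →ₘ[μ] ℂ) t ∂μ) ∧
          (∀ f g : WeightedStepClosure P ω, DS f g = D f g) ∧
          IsDerivation m D ∧ ¬ IsInner m D ∧
          IsDerivation mS DS ∧ ¬ IsInner mS DS :=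
  mainTheorem2_general μ P ω m hm ξ hξ hξ0
    (hcase.imp (fun h => ⟨hbdd, P.exists_Ψ_le_mul_sq h⟩) And.right)
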